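/- Let $\mathbb H^3=\{(x_1,x_2,x_3)\in\mathbb R^3 : x_3>0\}$ with the metric $\langle\cdot,\cdot\rangle=x_3^{-2}\langle\cdot,\cdot\rangle_e$ and Levi-Civita connection $\nabla^0$. Let $\mathcal V$ be a unit anti-torqued vector field on $\mathbb H^3$: a smooth vector field, defined on all of $\mathbb H^3$, with $|\mathcal V|=1$ and $$\nabla^0_X\mathcal V=f\,(X-\langle X,\mathcal V\rangle\mathcal V)\quad\text{for all } X,$$ where the smooth function $f$ (the conformal scalar) is nowhere zero on $\mathbb H^3$. Let $\phi:N\to\mathbb H^3$ be a smooth immersion of a surface with smooth unit normal field $U$, and let $A(X)=-\nabla^0_XU$ be its shape operator. Suppose that $N$ is a constant angle surface with axis $\mathcal V$: $\langle U,\mathcal V\rangle=\cos\theta$ on $N$ for a constant $\theta\in[0,\pi]$, and the tangential part $\mathcal V^\top$ of $\mathcal V$ vanishes nowhere on $N$. Suppose also that $\cos\theta\neq0$, and put $T=\mathcal V^\top/|\mathcal V^\top|$. Then $f$ is equal to a nonzero constant $f_0$ on $\mathbb H^3$, and there is a smooth function $\kappa_2$ on $N$ such that, at every point of $N$, the principal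 curvatures are the constant $\kappa_1=-f_0\cos\theta$, with principal direction $T$, and $\kappa_2$, with principal direction orthogonal to $T$. Moreover, around every point of $N$ there are smooth local coordinates $(s,t)$ with $\partial_s=T$ in which the induced metric has the form $ds^2+\lambda^2dt^2$, where $\lambda>0$ is smooth, and in all such coordinates $$\partial_s\kappa_2(s,t)=-\frac{1}{\sin\theta}\,\bigl(f_0\cos\theta+\kappa_2(s,t)\bigr)\bigl(\cos\theta\,\kappa_2(s,t)+f_0\bigr).$$ -/

import Mathlib

open scoped Manifold ContDiff

noncomputable section

namespace ConstantAngle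

/-- Ambient coordinate space `ℝ³`; the coordinates `x₁, x₂, x₃` are `p 0, p 1, p 2`. -/
abbrev E3 : Type := EuclideanSpace ℝ (Fin 3)

/-- The parameter plane, with coordinates `(s, t) = (x 0, x 1)`. -/
abbrev E2 : Type := EuclideanSpace ℝ (Fin 2)

/-- The vertical coordinate field `∂₃`. -/
def vert : E3 := EuclideanSpace.single 2 1

/-! ### Hyperbolic space, upper half-space model -/

/-- The upper half-space `{x₃ > 0}`. -/
def hyp : Set E3 := {p | 0 < p 2}

/-- The hyperbolic metric `⟨X, Y⟩ₑ / x₃²` on tangent vectors at `p`. -/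
def hypInner (p X Y : E3) : ℝ := inner ℝ X Y / (p 2) ^ 2

/-- Length of a tangent vector at `p` in the hyperbolic metric. -/
def hypNorm (p X : E3) : ℝ := Real.sqrt (hypInner p X X)

/-- The Christoffel term of the hyperbolic metric in the coordinates of `ℝ³`:
`Γ(X, Y) = (- X₃ Y - Y₃ X + ⟨X, Y⟩ₑ ∂₃) / x₃`. -/
def christoffel (p X Y : E3) : E3 :=
  (p 2)⁻¹ • (-(X 2) • Y - (Y 2) • X + (inner ℝ X Y : ℝ) • vert)

/-- The Levi-Civita derivative `∇⁰_X V` at `p` of a vector field `V` on hyperbolic space. -/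
def nabla (V : E3 → E3) (p X : E3) : E3 := fderiv ℝ V p X + christoffel p X (V p)

/-- `nabla` is torsion-free. -/
theorem nabla_torsion_free (V W : E3 → E3) (p : E3) :
    nabla W p (V p) - nabla V p (W p) = VectorField.lieBracket ℝ V W p := by
  simp only [nabla, christoffel, VectorField.lieBracket, real_inner_comm (V p) (W p)]
  module

theorem christoffel_metric (p : E3) (hp : p ∈ hyp) (X Y Z : E3) :
    hypInner p (christoffel p X Y) Z + hypInner p Y (christoffel p X Z)
      = -2 * X 2 / p 2 * hypInner p Y Z := by
  have h : p 2 ≠ 0 := ne_of_gt hp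
  have e (W : E3) : inner ℝ vert W = W 2 := by
    simp [vert, EuclideanSpace.inner_single_left]
  have e' (W : E3) : inner ℝ W vert = W 2 := by
    simp [vert, EuclideanSpace.inner_single_right]
  simp only [hypInner, christoffel, inner_add_left, inner_add_right, inner_sub_left,
    inner_sub_right, real_inner_smul_left, real_inner_smul_right, e, e']
  rw [real_inner_comm X Y]
  field_simp
  ring

/-- `nabla` is compatible with the hyperbolic metric. -/
theorem nabla_metric (V W : E3 → E3) (p : E3) (hp : p ∈ hyp)
    (hV : DifferentiableAt ℝ V p) (hW : DifferentiableAt ℝ W p) (X : E3) :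
    fderiv ℝ (fun q => hypInner q (V q) (W q)) p X
      = hypInner p (nabla V p X) (W p) + hypInner p (V p) (nabla W p X) := by
  have h : p 2 ≠ 0 := ne_of_gt hp
  have h2 : HasFDerivAt (fun q : E3 => q 2) (EuclideanSpace.proj (2 : Fin 3) : E3 →L[ℝ] ℝ) p :=
    (EuclideanSpace.proj (2 : Fin 3) : E3 →L[ℝ] ℝ).hasFDerivAt
  have h3 := (hV.hasFDerivAt.inner ℝ hW.hasFDerivAt).mul
    ((hasDerivAt_inv (pow_ne_zero 2 h)).comp_hasFDerivAt p (h2.pow 2))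
  have h4 : (fun q => hypInner q (V q) (W q))
      = fun q => inner ℝ (V q) (W q) * ((q 2) ^ 2)⁻¹ := by
    funext q; simp [hypInner, div_eq_mul_inv]
  have key := christoffel_metric p hp X (V p) (W p)
  have h5 : fderiv ℝ (fun q => hypInner q (V q) (W q)) p X
      = hypInner p (fderiv ℝ V p X) (W p) + hypInner p (V p) (fderiv ℝ W p X)
        + -2 * X 2 / p 2 * hypInner p (V p) (W p) := by
    rw [h4]
    refine (congrArg (fun L : E3 →L[ℝ] ℝ => L X) h3.fderiv).trans ?_
    simp [hypInner]
    field_simp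
    ring
  rw [h5, ← key]
  simp only [nabla, hypInner, inner_add_left, inner_add_right]
  ring

/-! ### Torse-forming and anti-torqued vector fields on hyperbolic space -/

/-- The `1`-form dual to the vector field `V`, i.e. `X ↦ ⟨X, V⟩`. -/
def dualForm (V : E3 → E3) (p : E3) : E3 →L[ℝ] ℝ := ((p 2) ^ 2)⁻¹ • innerSL ℝ (V p)

theorem dualForm_apply (V : E3 → E3) (p X : E3) : dualForm V p X = hypInner p X (V p) := by
  simp [dualForm, hypInner, div_eq_inv_mul, real_inner_comm]

/-- `V` is a smooth torse-forming field on hyperbolic space with conformal scalar `f` and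
generating form `η`: `∇⁰_X V = f X + η(X) V`. -/
structure IsTorseForming (V : E3 → E3) (f : E3 → ℝ) (η : E3 → E3 →L[ℝ] ℝ) : Prop where
  smooth_field : ContDiffOn ℝ ∞ V hyp
  smooth_scalar : ContDiffOn ℝ ∞ f hyp
  smooth_form : ContDiffOn ℝ ∞ η hyp
  eqn : ∀ p ∈ hyp, ∀ X : E3, nabla V p X = f p • X + η p X • V p

/-- `V` is a unit anti-torqued field on hyperbolic space with nowhere zero conformal scalar `f`:
it is a unit torse-forming field whose generating form is `-f` times its dual form. -/
structure IsUnitAntiTorqued (V : E3 → E3) (f : E3 → ℝ) : Prop where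
  torseForming : ∃ η, IsTorseForming V f η ∧ ∀ p ∈ hyp, η p = -f p • dualForm V p
  unit : ∀ p ∈ hyp, hypInner p (V p) (V p) = 1
  scalar_ne_zero : ∀ p ∈ hyp, f p ≠ 0

/-! ### Immersed surfaces -/

section Surface

variable {N : Type*} [TopologicalSpace N] [ChartedSpace E2 N]

/-- The differential of a map `N → ℝ³`. -/
def diff (φ : N → E3) (p : N) : TangentSpace (𝓡 2) p →L[ℝ] E3 := mfderiv (𝓡 2) 𝓘(ℝ, E3) φ p

/-- `φ` is a smooth immersion of the surface `N` into hyperbolic space and `U` is a smooth unit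
normal vector field along `φ`. -/
structure IsOrientedSurface (φ U : N → E3) : Prop where
  mem_hyp : ∀ p, φ p ∈ hyp
  smooth : ContMDiff (𝓡 2) 𝓘(ℝ, E3) ∞ φ
  immersion : ∀ p, Function.Injective (diff φ p)
  smooth_normal : ContMDiff (𝓡 2) 𝓘(ℝ, E3) ∞ U
  unit : ∀ p, hypInner (φ p) (U p) (U p) = 1
  normal : ∀ p (X : TangentSpace (𝓡 2) p), hypInner (φ p) (U p) (diff φ p X) = 0

/-- The induced metric on `N` at `p`. -/
def inducedInner (φ : N → E3) (p : N) (X Y : TangentSpace (𝓡 2) p) : ℝ :=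
  hypInner (φ p) (diff φ p X) (diff φ p Y)

/-- The Levi-Civita derivative `∇⁰_X W`, at `p` in the direction `X` tangent to `N`, of an ambient
vector field `W` along `φ`. -/
def nablaAlong (φ W : N → E3) (p : N) : TangentSpace (𝓡 2) p →ₗ[ℝ] E3 where
  toFun X := diff W p X + christoffel (φ p) (diff φ p X) (W p)
  map_add' X Y := by
    simp only [christoffel, map_add, inner_add_left, PiLp.add_apply]; module
  map_smul' c X := by
    simp only [christoffel, map_smul, real_inner_smul_left, PiLp.smul_apply, smul_eq_mul,
      RingHom.id_apply]; module

/-- The tangent vector of `N` at `p` whose image under the differential of the immersion `φ` is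
`w`. It is only used for `w` in the range of that differential, where it does not depend on the
choice of the left inverse. -/
def pullVec (φ : N → E3) (p : N) : E3 →ₗ[ℝ] TangentSpace (𝓡 2) p :=
  (diff φ p).toLinearMap.leftInverse

/-- The shape operator `A X = -∇⁰_X U`. -/
def shapeOperator (φ U : N → E3) (p : N) : Module.End ℝ (TangentSpace (𝓡 2) p) :=
  -(pullVec φ p ∘ₗ nablaAlong φ U p)

/-- Vectors orthogonal to the unit normal are tangent to the surface. -/
theorem mem_range_diff_of_orthogonal (φ U : N → E3) (h : IsOrientedSurface φ U) (p : N) (w : E3)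
    (hw : hypInner (φ p) w (U p) = 0) : ∃ Y, diff φ p Y = w := by
  have hp : (φ p) 2 ≠ 0 := ne_of_gt (h.mem_hyp p)
  have hU : U p ≠ 0 := by
    intro h0
    have := h.unit p
    simp [hypInner, h0] at this
  have hle : LinearMap.range (diff φ p).toLinearMap ≤ (ℝ ∙ U p)ᗮ := by
    rintro _ ⟨Y, rfl⟩
    rw [Submodule.mem_orthogonal_singleton_iff_inner_right]
    have := h.normal p Y
    simpa [hypInner, hp] using this
  have hf : Module.finrank ℝ (LinearMap.range (diff φ p).toLinearMap) = 2 := by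
    rw [LinearMap.finrank_range_of_inj (h.immersion p)]
    exact finrank_euclideanSpace_fin
  have hg : Module.finrank ℝ ((ℝ ∙ U p)ᗮ : Submodule ℝ E3) = 2 := by
    have : Fact (Module.finrank ℝ E3 = 2 + 1) := ⟨finrank_euclideanSpace_fin⟩
    exact Submodule.finrank_orthogonal_span_singleton hU
  have heq := Submodule.eq_of_le_of_finrank_eq hle (hf.trans hg.symm)
  have : w ∈ LinearMap.range (diff φ p).toLinearMap := by
    rw [heq, Submodule.mem_orthogonal_singleton_iff_inner_left]
    simpa [hypInner, hp] using hw
  exact this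

/-- On an oriented surface the field `∇⁰_X U` is tangent and the shape operator satisfies
`dφ(A X) = -∇⁰_X U`. -/
theorem diff_shapeOperator (φ U : N → E3) (h : IsOrientedSurface φ U) (p : N)
    (X : TangentSpace (𝓡 2) p) : diff φ p (shapeOperator φ U p X) = -nablaAlong φ U p X := by
  have hU0 : hypInner (φ p) (nablaAlong φ U p X) (U p) = 0 := by
    have hp : (φ p) 2 ≠ 0 := ne_of_gt (h.mem_hyp p)
    have hφ : HasMFDerivAt (𝓡 2) 𝓘(ℝ, E3) φ p (diff φ p) :=
      ((h.smooth p).mdifferentiableAt (by simp)).hasMFDerivAt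
    have hU : HasMFDerivAt (𝓡 2) 𝓘(ℝ, E3) U p (diff U p) :=
      ((h.smooth_normal p).mdifferentiableAt (by simp)).hasMFDerivAt
    have h1 : HasFDerivAt (fun y : E3 => inner ℝ y y) (2 • innerSL ℝ (U p)) (U p) := by
      have := (hasFDerivAt_id (𝕜 := ℝ) (U p)).inner ℝ (hasFDerivAt_id (U p))
      refine this.congr_fderiv ?_
      ext Y; simp [real_inner_comm, two_mul]
    have h2 : HasFDerivAt (fun y : E3 => (y 2) ^ 2)
        ((2 * (φ p) 2) • (EuclideanSpace.proj (2 : Fin 3) : E3 →L[ℝ] ℝ)) (φ p) := by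
      refine ((EuclideanSpace.proj (2 : Fin 3) : E3 →L[ℝ] ℝ).hasFDerivAt.pow 2).congr_fderiv ?_
      ext Y; simp
    have h3 := h1.hasMFDerivAt.comp p hU
    have h4 := h2.hasMFDerivAt.comp p hφ
    have h5 : (fun y : E3 => inner ℝ y y) ∘ U = (fun y : E3 => (y 2) ^ 2) ∘ φ := by
      funext q
      have := h.unit q
      have hq : (φ q) 2 ≠ 0 := ne_of_gt (h.mem_hyp q)
      simp only [hypInner] at this
      simp only [Function.comp]
      field_simp at this
      linarith
    rw [h5] at h3
    have h6 : (2 • innerSL ℝ (U p)) (diff U p X) = ((2 * (φ p) 2) •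
        (EuclideanSpace.proj (2 : Fin 3) : E3 →L[ℝ] ℝ)) (diff φ p X) :=
      congrArg (fun L => L X) (hasMFDerivAt_unique h3 h4)
    have h7 : 2 * (inner ℝ (U p) (diff U p X) : ℝ) = 2 * (φ p) 2 * (diff φ p X) 2 := by
      simpa using h6
    have h8 := h.unit p
    have h9 := christoffel_metric (φ p) (h.mem_hyp p) (diff φ p X) (U p) (U p)
    rw [h8] at h9
    have h10 : hypInner (φ p) (U p) (christoffel (φ p) (diff φ p X) (U p))
        = hypInner (φ p) (christoffel (φ p) (diff φ p X) (U p)) (U p) := by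
      simp only [hypInner, real_inner_comm]
    have h11 : hypInner (φ p) (diff U p X) (U p) = (diff φ p X) 2 / (φ p) 2 := by
      simp only [hypInner]
      rw [real_inner_comm]
      field_simp
      linarith
    have h12 : hypInner (φ p) (nablaAlong φ U p X) (U p) = hypInner (φ p) (diff U p X) (U p)
        + hypInner (φ p) (christoffel (φ p) (diff φ p X) (U p)) (U p) := by
      simp only [nablaAlong, hypInner, LinearMap.coe_mk, AddHom.coe_mk, inner_add_left]
      ring
    rw [h12, h11]
    rw [h10] at h9
    have : -2 * (diff φ p X) 2 / (φ p) 2 * 1 = -2 * ((diff φ p X) 2 / (φ p) 2) := by ring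
    linarith
  obtain ⟨Y, hY⟩ := mem_range_diff_of_orthogonal φ U h p _ hU0
  have hk : LinearMap.ker (diff φ p).toLinearMap = ⊥ :=
    LinearMap.ker_eq_bot.2 (h.immersion p)
  have h13 : shapeOperator φ U p X = -Y := by
    have := LinearMap.leftInverse_apply_of_inj hk Y
    simp only [shapeOperator, pullVec, LinearMap.neg_apply, LinearMap.comp_apply, ← hY]
    exact congrArg Neg.neg this
  rw [h13, map_neg, hY]

/-- The tangential part on `N`, at `p`, of the ambient field `V`:
`V^⊤ = V - ⟨V, U⟩ U`. -/
def tangentPart (φ U : N → E3) (V : E3 → E3) (p : N) : TangentSpace (𝓡 2) p :=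
  pullVec φ p (V (φ p) - hypInner (φ p) (V (φ p)) (U p) • U p)

/-- The normalised tangential part `T = V^⊤ / |V^⊤|`. -/
def unitTangentPart (φ U : N → E3) (V : E3 → E3) (p : N) : TangentSpace (𝓡 2) p :=
  (Real.sqrt (inducedInner φ p (tangentPart φ U V p) (tangentPart φ U V p)))⁻¹ •
    tangentPart φ U V p

/-- The oriented immersed surface `(φ, U)` is a constant angle surface with axis `V` and angle
`θ`: `V^⊤` is nowhere zero on `N` and `⟨U, V⟩ = cos θ`. -/
structure IsConstantAngleSurface (φ U : N → E3) (V : E3 → E3) (θ : ℝ) : Prop where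
  surface : IsOrientedSurface φ U
  angle_mem : θ ∈ Set.Icc 0 Real.pi
  angle : ∀ p, hypInner (φ p) (U p) (V (φ p)) = Real.cos θ
  tangentPart_ne_zero : ∀ p, tangentPart φ U V p ≠ 0

/-- The coordinate vector field `∂ᵢ` of a chart, at the point with coordinates `x`. -/
def coordField (c : OpenPartialHomeomorph N E2) (i : Fin 2) (x : E2) :
    TangentSpace (𝓡 2) (c.symm x) :=
  mfderiv (𝓡 2) (𝓡 2) c.symm x (EuclideanSpace.single i (1 : ℝ) : E2)

/-- A smooth local coordinate system `(s, t)` on `N` with `∂_s = T` in which the induced metric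
is `ds² + λ² dt²`. -/
structure IsAdaptedChart (φ U : N → E3) (V : E3 → E3) (c : OpenPartialHomeomorph N E2) :
    Prop where
  mem_atlas : c ∈ IsManifold.maximalAtlas (𝓡 2) ∞ N
  ds_eq : ∀ x ∈ c.target, coordField c 0 x = unitTangentPart φ U V (c.symm x)
  metric : ∃ lam : E2 → ℝ, ContDiffOn ℝ ∞ lam c.target ∧ ∀ x ∈ c.target, 0 < lam x ∧
    inducedInner φ (c.symm x) (coordField c 0 x) (coordField c 0 x) = 1 ∧
    inducedInner φ (c.symm x) (coordField c 0 x) (coordField c 1 x) = 0 ∧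
    inducedInner φ (c.symm x) (coordField c 1 x) (coordField c 1 x) = lam x ^ 2

end Surface

end ConstantAngle

end

open ConstantAngle

noncomputable section

namespace ConstantAngle

/-! ### The Euclidean unit field of an anti-torqued field -/

/-! The half-space metric is conformal to the Euclidean one, so everything is computed in ℝ³ with n
= V/x₃, ν = U/x₃ and ordinary derivatives. The equation of V becomes x₃ dn(X) = (f + n₃)X - ⟨X,n⟩(f
n + ∂₃) (`fderiv_euclidUnit`).

The scalar. Symmetry of the second derivative of n forces grad f = (1 - f²)V (`fderiv_scalar`). The
integral curves of V are complete geodesics, along which f solves g' = 1 - g² for all time. A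
solution other than ±1 is a shifted tanh, which has a zero, or a shifted coth, which blows up. Hence
f² = 1, and f is constant because the half-space is connected.

The curvatures. Differentiating ⟨ν,n⟩ = cos θ gives ⟨AX,V⟩ = -f cos θ ⟨X,V⟩. Since A is symmetric, T
is principal with curvature -f cos θ, and in dimension two the orthogonal direction is principal
too. Its curvature is the quotient of smooth functions in a chart. The evolution equation is the
Codazzi equation: the relations for ∂ₛψ, ∂ₛν and ∂ₜν, where ψ is the immersion in coordinates, are
differentiated crosswise and paired with ∂ₜψ.

The coordinates. Functions S and R are needed with dS = ⟨T,·⟩, dR(T) = 0 and independent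
differentials. View the space as the hyperboloid with position vector P, whose linear functions ℓ
have Hessian ℓ times the metric. The vector V - fP is null and keeps its direction, so pairing it
with a timelike covector gives a nowhere zero G (`potential`) with d log|G| = -f⟨V,·⟩; hence S =
-(f/sin θ) log|G|. Along T the vectors U - f cos θ P and G(V + fP - 2cos θ U) are constant, so
linear functions of them are first integrals (`transverseCoord`). In the direction e orthogonal to T
their derivatives are -(κ₂ + f cos θ)e and 2G(f + cos θ κ₂)e. These cannot both vanish when sin θ ≠
0, so a suitable combination serves as R near any given point. -/

theorem inner_vert_left (W : E3) : inner ℝ vert W = W 2 := by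
  simp [vert, EuclideanSpace.inner_single_left]

theorem inner_vert_right (W : E3) : inner ℝ W vert = W 2 := by
  simp [vert, EuclideanSpace.inner_single_right]

theorem vert_apply_two : vert 2 = 1 := by simp [vert]

theorem isOpen_hyp : IsOpen hyp :=
  isOpen_lt continuous_const (by fun_prop)

theorem hasFDerivAt_height (p : E3) :
    HasFDerivAt (fun q : E3 => q 2) (EuclideanSpace.proj (2 : Fin 3) : E3 →L[ℝ] ℝ) p :=
  (EuclideanSpace.proj (2 : Fin 3) : E3 →L[ℝ] ℝ).hasFDerivAt

theorem contDiff_height : ContDiff ℝ ∞ (fun q : E3 => q 2) :=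
  (EuclideanSpace.proj (2 : Fin 3) : E3 →L[ℝ] ℝ).contDiff

theorem hasDerivAt_height {γ : ℝ → E3} {X : E3} {t : ℝ} (h : HasDerivAt γ X t) :
    HasDerivAt (fun s => γ s 2) (X 2) t :=
  (hasFDerivAt_height (γ t)).comp_hasDerivAt t h

/-- The field `V`, rescaled to have Euclidean length equal to its hyperbolic length. -/
def euclidUnit (V : E3 → E3) (p : E3) : E3 := (p 2)⁻¹ • V p

theorem smul_euclidUnit {V : E3 → E3} {p : E3} (hp : p ∈ hyp) : p 2 • euclidUnit V p = V p := by
  have h : p 2 ≠ 0 := ne_of_gt hp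
  simp [euclidUnit, smul_smul, h]

theorem hypInner_smul_smul {p : E3} (hp : p ∈ hyp) (X Y : E3) :
    hypInner p (p 2 • X) (p 2 • Y) = inner ℝ X Y := by
  have h : p 2 ≠ 0 := ne_of_gt hp
  simp only [hypInner, real_inner_smul_left, real_inner_smul_right]
  field_simp

theorem hypInner_smul_right {p : E3} (hp : p ∈ hyp) (X Y : E3) :
    hypInner p X (p 2 • Y) = inner ℝ X Y / p 2 := by
  have h : p 2 ≠ 0 := ne_of_gt hp
  simp only [hypInner, real_inner_smul_right]
  field_simp

theorem exists_unit_orthogonal (a b : E3) :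
    ∃ x : E3, inner ℝ x x = (1 : ℝ) ∧ inner ℝ x a = (0 : ℝ) ∧ inner ℝ x b = (0 : ℝ) := by
  classical
  have hne : (Submodule.span ℝ ({a, b} : Set E3))ᗮ ≠ ⊥ := by
    intro h0
    have h1 := Submodule.finrank_add_finrank_orthogonal (Submodule.span ℝ ({a, b} : Set E3))
    rw [h0, finrank_bot, finrank_euclideanSpace_fin, add_zero] at h1
    have h2 := finrank_span_finset_le_card (R := ℝ) ({a, b} : Finset E3)
    have h3 : ({a, b} : Finset E3).card ≤ 2 := Finset.card_le_two
    rw [Finset.coe_insert, Finset.coe_singleton, Set.finrank] at h2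
    omega
  obtain ⟨z, hz, hz0⟩ := Submodule.exists_mem_ne_zero_of_ne_bot hne
  have hn : ‖z‖ ≠ 0 := norm_ne_zero_iff.2 hz0
  have hz' : ∀ c ∈ ({a, b} : Set E3), inner ℝ z c = (0 : ℝ) := fun c hc => by
    rw [real_inner_comm]
    exact (Submodule.mem_orthogonal _ _).1 hz c (Submodule.subset_span hc)
  refine ⟨‖z‖⁻¹ • z, ?_, ?_, ?_⟩
  · rw [real_inner_smul_left, real_inner_smul_right, real_inner_self_eq_norm_sq]
    field_simp
  · rw [real_inner_smul_left, hz' a (by simp), mul_zero]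
  · rw [real_inner_smul_left, hz' b (by simp), mul_zero]

namespace IsUnitAntiTorqued

variable {V : E3 → E3} {f : E3 → ℝ} (hV : IsUnitAntiTorqued V f)
include hV

theorem contDiffOn_field : ContDiffOn ℝ ∞ V hyp := by
  obtain ⟨η, h, -⟩ := hV.torseForming
  exact h.smooth_field

theorem contDiffOn_scalar : ContDiffOn ℝ ∞ f hyp := by
  obtain ⟨η, h, -⟩ := hV.torseForming
  exact h.smooth_scalar

theorem contDiffOn_euclidUnit : ContDiffOn ℝ ∞ (euclidUnit V) hyp :=
  (contDiff_height.contDiffOn.inv fun _ hp => ne_of_gt hp).smul hV.contDiffOn_field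

theorem contDiffAt_euclidUnit {p : E3} (hp : p ∈ hyp) : ContDiffAt ℝ ∞ (euclidUnit V) p :=
  hV.contDiffOn_euclidUnit.contDiffAt (isOpen_hyp.mem_nhds hp)

theorem hasFDerivAt_euclidUnit {p : E3} (hp : p ∈ hyp) :
    HasFDerivAt (euclidUnit V) (fderiv ℝ (euclidUnit V) p) p :=
  ((hV.contDiffAt_euclidUnit hp).differentiableAt (by simp)).hasFDerivAt

theorem hasFDerivAt_scalar {p : E3} (hp : p ∈ hyp) : HasFDerivAt f (fderiv ℝ f p) p :=
  ((hV.contDiffOn_scalar.contDiffAt (isOpen_hyp.mem_nhds hp)).differentiableAt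
    (by simp)).hasFDerivAt

theorem inner_euclidUnit {p : E3} (hp : p ∈ hyp) :
    inner ℝ (euclidUnit V p) (euclidUnit V p) = (1 : ℝ) := by
  rw [← hypInner_smul_smul hp, smul_euclidUnit hp, hV.unit p hp]

/-- The torse-forming equation with the Christoffel terms absorbed by the rescaling. All later
computations with V go through this identity. -/
theorem fderiv_euclidUnit {p : E3} (hp : p ∈ hyp) (X : E3) :
    p 2 • fderiv ℝ (euclidUnit V) p X = (f p + euclidUnit V p 2) • X -
      (inner ℝ X (euclidUnit V p) : ℝ) • (f p • euclidUnit V p + vert) := by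
  have h : p 2 ≠ 0 := ne_of_gt hp
  obtain ⟨η, hη, hη'⟩ := hV.torseForming
  have hD : HasFDerivAt V (fderiv ℝ V p) p :=
    ((hV.contDiffOn_field.contDiffAt (isOpen_hyp.mem_nhds hp)).differentiableAt
      (by simp)).hasFDerivAt
  have h1 := ((hasFDerivAt_height p).fun_smul (hV.hasFDerivAt_euclidUnit hp)).congr_of_eventuallyEq
    (f₁ := V) (by filter_upwards [isOpen_hyp.mem_nhds hp] with q hq using (smul_euclidUnit hq).symm)
  have h2 : fderiv ℝ V p X
      = p 2 • fderiv ℝ (euclidUnit V) p X + X 2 • euclidUnit V p := by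
    rw [h1.fderiv]; simp
  have h3 := hη.eqn p hp X
  rw [hη' p hp] at h3
  simp only [nabla, h2, smul_apply, dualForm_apply] at h3
  rw [← smul_euclidUnit (V := V) hp, hypInner_smul_right hp] at h3
  set n := euclidUnit V p
  simp only [christoffel, real_inner_smul_right, PiLp.smul_apply, smul_eq_mul] at h3
  have h4 : p 2 • fderiv ℝ (euclidUnit V) p X
      = f p • X + (-f p * (inner ℝ X n / p 2)) • p 2 • n - X 2 • n -
        (p 2)⁻¹ • (-X 2 • p 2 • n - (p 2 * n 2) • X + (p 2 * inner ℝ X n) • vert) := by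
    rw [← sub_eq_zero, ← sub_eq_zero.2 h3]; module
  rw [h4]
  match_scalars <;> field_simp <;> ring

/-- The derivative of the identity `fderiv_euclidUnit`. -/
theorem fderiv_fderiv_euclidUnit {p : E3} (hp : p ∈ hyp) (X Y : E3) :
    Y 2 • fderiv ℝ (euclidUnit V) p X + p 2 • fderiv ℝ (fderiv ℝ (euclidUnit V)) p Y X =
      (fderiv ℝ f p Y + fderiv ℝ (euclidUnit V) p Y 2) • X -
      (inner ℝ X (fderiv ℝ (euclidUnit V) p Y) : ℝ) • (f p • euclidUnit V p + vert) -
      (inner ℝ X (euclidUnit V p) : ℝ) •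
        (fderiv ℝ f p Y • euclidUnit V p + f p • fderiv ℝ (euclidUnit V) p Y) := by
  have hγ : HasDerivAt (fun t : ℝ => p + t • Y) Y 0 := by
    simpa using ((hasDerivAt_id (0 : ℝ)).smul_const Y).const_add p
  have hp0 : p + (0 : ℝ) • Y = p := by simp
  have hn : HasDerivAt (fun t : ℝ => euclidUnit V (p + t • Y)) (fderiv ℝ (euclidUnit V) p Y) 0 :=
    (hV.hasFDerivAt_euclidUnit hp).comp_hasDerivAt_of_eq 0 hγ hp0.symm
  have hf : HasDerivAt (fun t : ℝ => f (p + t • Y)) (fderiv ℝ f p Y) 0 :=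
    (hV.hasFDerivAt_scalar hp).comp_hasDerivAt_of_eq 0 hγ hp0.symm
  have hD : HasDerivAt (fun t : ℝ => fderiv ℝ (euclidUnit V) (p + t • Y) X)
      (fderiv ℝ (fderiv ℝ (euclidUnit V)) p Y X) 0 := by
    have h1 : HasFDerivAt (fderiv ℝ (euclidUnit V)) (fderiv ℝ (fderiv ℝ (euclidUnit V)) p) p :=
      (((hV.contDiffAt_euclidUnit hp).fderiv_right (m := 1) (by norm_cast)).differentiableAt
        (by simp)).hasFDerivAt
    have h2 : HasDerivAt (fun t : ℝ => fderiv ℝ (euclidUnit V) (p + t • Y))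
        (fderiv ℝ (fderiv ℝ (euclidUnit V)) p Y) 0 :=
      h1.comp_hasDerivAt_of_eq 0 hγ hp0.symm
    have := h2.clm_apply (hasDerivAt_const (0 : ℝ) X)
    simpa using this
  have hL := (hasDerivAt_height hγ).fun_smul hD
  have hR := ((hf.fun_add (hasDerivAt_height hn)).smul_const X).fun_sub
    (((hasDerivAt_const (0 : ℝ) X).inner ℝ hn).fun_smul ((hf.fun_smul hn).add_const vert))
  have hR' := hR.congr_of_eventuallyEq
    (f₁ := fun t : ℝ => (p + t • Y) 2 • fderiv ℝ (euclidUnit V) (p + t • Y) X) (by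
      have hc : ContinuousAt (fun t : ℝ => p + t • Y) 0 := hγ.continuousAt
      filter_upwards [hc.preimage_mem_nhds (isOpen_hyp.mem_nhds (by rwa [hp0]))] with t ht
      exact hV.fderiv_euclidUnit ht X)
  have := hL.unique hR'
  rw [hp0, inner_zero_left] at this
  rw [add_comm, this]
  module

/-- The Ricci identity for an anti-torqued field. -/
theorem fderiv_scalar {p : E3} (hp : p ∈ hyp) (Y : E3) :
    p 2 * fderiv ℝ f p Y = (1 - f p ^ 2) * inner ℝ Y (euclidUnit V p) := by
  have hy : p 2 ≠ 0 := ne_of_gt hp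
  -- Pairing with a unit X orthogonal to both n and Y isolates the derivative of f along Y in the
  -- difference of the two mixed second derivatives.
  obtain ⟨X, hXX, hXn, hXY⟩ := exists_unit_orthogonal (euclidUnit V p) Y
  have hsym : IsSymmSndFDerivAt ℝ (euclidUnit V) p :=
    (hV.contDiffAt_euclidUnit hp).isSymmSndFDerivAt
      (by rw [minSmoothness_of_isRCLikeNormedField]; exact WithTop.coe_le_coe.2 (le_top (a := (2 : ℕ∞))))
  have h1 := hV.fderiv_fderiv_euclidUnit hp X Y
  have h2 := hV.fderiv_fderiv_euclidUnit hp Y X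
  rw [hsym.eq X Y] at h2
  have hX := hV.fderiv_euclidUnit hp X
  have hY := hV.fderiv_euclidUnit hp Y
  have hnn := hV.inner_euclidUnit hp
  set n := euclidUnit V p
  set LX := fderiv ℝ (euclidUnit V) p X
  set LY := fderiv ℝ (euclidUnit V) p Y
  set Q := fderiv ℝ (fderiv ℝ (euclidUnit V)) p Y X
  have k1 := congrArg (fun Z : E3 => (inner ℝ X Z : ℝ)) h1
  have k2 := congrArg (fun Z : E3 => (inner ℝ X Z : ℝ)) h2
  have kX := congrArg (fun Z : E3 => (inner ℝ X Z : ℝ)) hX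
  have kYX := congrArg (fun Z : E3 => (inner ℝ Y Z : ℝ)) hX
  have kXY := congrArg (fun Z : E3 => (inner ℝ X Z : ℝ)) hY
  have k3 := congrArg (fun Z : E3 => Z 2) hY
  have hYX : inner ℝ Y X = (0 : ℝ) := by rw [real_inner_comm]; exact hXY
  simp only [inner_add_right, inner_sub_right, real_inner_smul_right, inner_vert_right, hXX, hXn,
    hXY, hYX, PiLp.add_apply, PiLp.sub_apply, PiLp.smul_apply, smul_eq_mul, vert_apply_two,
    mul_zero, zero_mul, mul_one, zero_add, sub_zero, zero_sub] at k1 k2 kX kYX kXY k3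
  linear_combination -(p 2) * (k1 - k2) + (Y 2 - inner ℝ Y n * f p) * kX - k3 - X 2 * kYX

end IsUnitAntiTorqued

/-! ### The conformal scalar is constant -/

/-- Integrating factor: u · exp(-∫k) has zero derivative. -/
theorem eq_zero_of_hasDerivAt_mul {u k : ℝ → ℝ} (hk : Continuous k)
    (hu : ∀ t, HasDerivAt u (k t * u t) t) (h0 : u 0 = 0) (t : ℝ) : u t = 0 := by
  have hK (s : ℝ) : HasDerivAt (fun r => ∫ x in (0 : ℝ)..r, k x) (k s) s :=
    (hk.integral_hasStrictDerivAt 0 s).hasDerivAt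
  have hd (s : ℝ) :
      HasDerivAt (fun r => u r * Real.exp (-∫ x in (0 : ℝ)..r, k x)) 0 s := by
    refine ((hu s).fun_mul (hK s).fun_neg.exp).congr_deriv ?_
    ring
  have := is_const_of_deriv_eq_zero (fun s => (hd s).differentiableAt) (fun s => (hd s).deriv) t 0
  simpa [h0, Real.exp_ne_zero] using this

/-- A nowhere zero solution of `g' = 1 - g²` on the whole line is `±1`. -/
theorem sq_eq_one_of_riccati {g : ℝ → ℝ} (hg : ∀ t, HasDerivAt g (1 - g t ^ 2) t)
    (h0 : ∀ t, g t ≠ 0) : g 0 ^ 2 = 1 := by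
  by_contra hne
  have hgc : Continuous g := continuous_iff_continuousAt.2 fun t => (hg t).continuousAt
  set a := g 0
  -- The expected solution is (sinh + a cosh)/(cosh + a sinh). Cleared of its denominator, the
  -- defect solves a linear equation u' = -g u with u(0) = 0, so it vanishes even where the
  -- denominator does.
  have hu (t : ℝ) : HasDerivAt
      (fun s => g s * (Real.cosh s + a * Real.sinh s) - (Real.sinh s + a * Real.cosh s))
      (-g t * (g t * (Real.cosh t + a * Real.sinh t) - (Real.sinh t + a * Real.cosh t))) t := by
    refine (((hg t).fun_mul ((Real.hasDerivAt_cosh t).fun_add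
      ((Real.hasDerivAt_sinh t).const_mul a))).fun_sub ((Real.hasDerivAt_sinh t).fun_add
      ((Real.hasDerivAt_cosh t).const_mul a))).congr_deriv ?_
    ring
  have key (t : ℝ) := eq_zero_of_hasDerivAt_mul hgc.neg hu (by simp [a]) t
  have hm : 1 - a ≠ 0 := fun h => hne (by rw [← sub_eq_zero]; linear_combination (-1 - a) * h)
  have hp : 1 + a ≠ 0 := fun h => hne (by rw [← sub_eq_zero]; linear_combination (a - 1) * h)
  -- At t = ½ log|q| either the numerator (if q > 0) or the denominator (if q < 0) vanishes. As g(t)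
  -- ≠ 0, both then vanish, although the difference of their squares is 1 - a² ≠ 0.
  set q := (1 - a) / (1 + a) with hq
  have hq0 : q ≠ 0 := div_ne_zero hm hp
  set t := Real.log |q| / 2 with ht
  have he : Real.exp t * Real.exp t = |q| := by
    rw [← Real.exp_add, ht, add_halves, Real.exp_log (abs_pos.2 hq0)]
  have hx := Real.cosh_sq t
  have hprod : (Real.cosh t + a * Real.sinh t) * (Real.sinh t + a * Real.cosh t) = 0 := by
    have h4 : Real.exp t * Real.exp (-t) = 1 := by rw [← Real.exp_add]; simp
    have h5 : (Real.exp t * Real.exp t) ^ 2 * (1 + a) ^ 2 = (1 - a) ^ 2 := by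
      rw [he, sq_abs, hq]; field_simp
    rw [Real.cosh_eq, Real.sinh_eq]
    have h6 : Real.exp t ≠ 0 := Real.exp_ne_zero t
    have h7 : Real.exp (-t) = (Real.exp t)⁻¹ := Real.exp_neg t
    rw [h7]
    field_simp
    linear_combination h5
  have k := key t
  have hcs : (Real.cosh t + a * Real.sinh t) ^ 2 - (Real.sinh t + a * Real.cosh t) ^ 2
      = 1 - a ^ 2 := by linear_combination (1 - a ^ 2) * hx
  apply hne
  rcases mul_eq_zero.1 hprod with h | h
  · rw [h, mul_zero, zero_sub, neg_eq_zero] at k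
    rw [h, k] at hcs; linarith
  · rw [h, sub_zero] at k
    have h8 := (mul_eq_zero.1 k).resolve_left (h0 t)
    rw [h, h8] at hcs; linarith

/-- The conformal factor along the hyperbolic geodesic with initial direction of slope `c`. -/
def geodesicDenom (c t : ℝ) : ℝ := Real.cosh t - c * Real.sinh t

/-- The hyperbolic geodesic starting at `p` in the direction of the Euclidean unit vector `n`. -/
def geodesic (p n : E3) (t : ℝ) : E3 :=
  p + (p 2 / geodesicDenom (n 2) t) • (Real.sinh t • n + (1 - Real.cosh t) • vert)

/-- The Euclidean unit tangent of `geodesic p n`. -/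
def geodesicDir (n : E3) (t : ℝ) : E3 :=
  (geodesicDenom (n 2) t)⁻¹ • (n - (n 2) • vert -
    (Real.sinh t - n 2 * Real.cosh t) • vert)

theorem abs_apply_two_le {n : E3} (hn : inner ℝ n n = (1 : ℝ)) : |n 2| ≤ 1 := by
  have h1 : ‖n‖ = 1 := by
    rw [real_inner_self_eq_norm_sq] at hn
    exact (pow_eq_one_iff_of_nonneg (norm_nonneg n) two_ne_zero).1 hn
  rw [← h1]; exact PiLp.norm_apply_le n 2

theorem geodesicDenom_pos {c : ℝ} (hc : |c| ≤ 1) (t : ℝ) : 0 < geodesicDenom c t := by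
  have h1 : c * Real.sinh t ≤ |Real.sinh t| :=
    (le_abs_self _).trans (by
      rw [abs_mul]; exact mul_le_of_le_one_left (abs_nonneg _) hc)
  have h2 : |Real.sinh t| < Real.cosh t :=
    abs_lt.2 ⟨by linarith [Real.cosh_eq t, Real.sinh_eq t, Real.exp_pos t], Real.sinh_lt_cosh t⟩
  unfold geodesicDenom; linarith

theorem hasDerivAt_geodesicDenom (c t : ℝ) :
    HasDerivAt (geodesicDenom c) (Real.sinh t - c * Real.cosh t) t :=
  (Real.hasDerivAt_cosh t).fun_sub ((Real.hasDerivAt_sinh t).const_mul c)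

theorem geodesic_apply_two (p n : E3) (hn : inner ℝ n n = (1 : ℝ)) (t : ℝ) :
    geodesic p n t 2 = p 2 / geodesicDenom (n 2) t := by
  have h := (geodesicDenom_pos (abs_apply_two_le hn) t).ne'
  simp only [geodesic, PiLp.add_apply, PiLp.smul_apply, smul_eq_mul, vert_apply_two]
  field_simp
  unfold geodesicDenom; ring

theorem geodesicDir_apply_two (n : E3) (t : ℝ) : geodesicDir n t 2
    = -(geodesicDenom (n 2) t)⁻¹ * (Real.sinh t - n 2 * Real.cosh t) := by
  simp only [geodesicDir, PiLp.sub_apply, PiLp.smul_apply, smul_eq_mul, vert_apply_two]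
  ring

theorem hasDerivAt_geodesic (p n : E3) (hn : inner ℝ n n = (1 : ℝ)) (t : ℝ) :
    HasDerivAt (geodesic p n) (geodesic p n t 2 • geodesicDir n t) t := by
  have h := (geodesicDenom_pos (abs_apply_two_le hn) t).ne'
  have h1 := ((((hasDerivAt_geodesicDenom (n 2) t).fun_inv h).const_mul (p 2)).fun_smul
    (((Real.hasDerivAt_sinh t).smul_const n).fun_add
      (((Real.hasDerivAt_cosh t).const_sub 1).smul_const vert))).const_add p
  refine (h1.congr_deriv ?_)
  rw [geodesic_apply_two p n hn, geodesicDir]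
  have hx := Real.cosh_sq t
  match_scalars <;> field_simp <;> unfold geodesicDenom
  · linear_combination p 2 * hx
  · ring_nf; rw [hx]; ring

/-- The geodesic equation: for γ' = x₃τ, vanishing of the covariant derivative of γ' reads τ' = τ₃τ
- ∂₃. -/
theorem hasDerivAt_geodesicDir (n : E3) (hn : inner ℝ n n = (1 : ℝ)) (t : ℝ) :
    HasDerivAt (geodesicDir n) (geodesicDir n t 2 • geodesicDir n t - vert) t := by
  have h := (geodesicDenom_pos (abs_apply_two_le hn) t).ne'
  have h1 := ((hasDerivAt_geodesicDenom (n 2) t).fun_inv h).fun_smul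
    ((((Real.hasDerivAt_sinh t).fun_sub ((Real.hasDerivAt_cosh t).const_mul (n 2))).smul_const
      vert).const_sub (n - (n 2) • vert))
  refine h1.congr_deriv ?_
  rw [geodesicDir_apply_two, geodesicDir]
  have hx := Real.cosh_sq t
  match_scalars <;> field_simp
  unfold geodesicDenom
  ring

theorem inner_geodesicDir (n : E3) (hn : inner ℝ n n = (1 : ℝ)) (t : ℝ) :
    inner ℝ (geodesicDir n t) (geodesicDir n t) = (1 : ℝ) := by
  have h := (geodesicDenom_pos (abs_apply_two_le hn) t).ne'
  have hx := Real.cosh_sq t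
  simp only [geodesicDir, real_inner_smul_left, real_inner_smul_right, inner_sub_left,
    inner_sub_right, inner_vert_left, inner_vert_right, vert_apply_two, hn]
  field_simp
  unfold geodesicDenom
  ring_nf; rw [hx]; ring

theorem vert_mem_hyp : vert ∈ hyp := by
  simp [hyp, vert_apply_two]

namespace IsUnitAntiTorqued

variable {V : E3 → E3} {f : E3 → ℝ} (hV : IsUnitAntiTorqued V f)
include hV

/-- No flow of V is needed. On the explicit geodesic leaving p in the direction V, the cosine a
between its tangent and V satisfies a' = f(1 - a²) and a(0) = 1, so a ≡ 1. Thus f solves the Riccati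
equation on all of ℝ. -/
theorem scalar_sq_eq_one {p : E3} (hp : p ∈ hyp) : f p ^ 2 = 1 := by
  set n₀ := euclidUnit V p with hn₀
  have hn : inner ℝ n₀ n₀ = (1 : ℝ) := hV.inner_euclidUnit hp
  have h0 : geodesic p n₀ 0 = p := by simp [geodesic]
  have hmem (t : ℝ) : geodesic p n₀ t ∈ hyp := by
    change 0 < geodesic p n₀ t 2
    rw [geodesic_apply_two p n₀ hn]
    exact div_pos hp (geodesicDenom_pos (abs_apply_two_le hn) t)
  set γ := geodesic p n₀
  set τ := geodesicDir n₀
  have hγ (t : ℝ) : HasDerivAt γ (γ t 2 • τ t) t := hasDerivAt_geodesic p n₀ hn t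
  have hτ (t : ℝ) : HasDerivAt τ (τ t 2 • τ t - vert) t := hasDerivAt_geodesicDir n₀ hn t
  have hnd (t : ℝ) : HasDerivAt (fun s => euclidUnit V (γ s))
      ((f (γ t) + euclidUnit V (γ t) 2) • τ t -
        (inner ℝ (τ t) (euclidUnit V (γ t)) : ℝ) • (f (γ t) • euclidUnit V (γ t) + vert)) t := by
    refine ((hV.hasFDerivAt_euclidUnit (hmem t)).comp_hasDerivAt t (hγ t)).congr_deriv ?_
    rw [map_smul, hV.fderiv_euclidUnit (hmem t)]
  set a : ℝ → ℝ := fun t => inner ℝ (τ t) (euclidUnit V (γ t)) with ha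
  have hfd (t : ℝ) : HasDerivAt (fun s => f (γ s)) ((1 - f (γ t) ^ 2) * a t) t := by
    refine ((hV.hasFDerivAt_scalar (hmem t)).comp_hasDerivAt t (hγ t)).congr_deriv ?_
    rw [map_smul, smul_eq_mul, hV.fderiv_scalar (hmem t)]
  have had (t : ℝ) : HasDerivAt a (f (γ t) * (1 - a t ^ 2)) t := by
    refine ((hτ t).inner ℝ (hnd t)).congr_deriv ?_
    have h1 := inner_geodesicDir n₀ hn t
    simp only [inner_sub_right, inner_sub_left, inner_add_right, real_inner_smul_right,
      real_inner_smul_left, inner_vert_left, inner_vert_right]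
    change (inner ℝ (τ t) (τ t) : ℝ) = 1 at h1
    rw [h1, ha]; ring
  have hac : Continuous a := continuous_iff_continuousAt.2 fun t => (had t).continuousAt
  have hfc : Continuous fun t => f (γ t) :=
    continuous_iff_continuousAt.2 fun t => (hfd t).continuousAt
  have ha0 : a 0 = 1 := by
    have : τ 0 = n₀ := by simp [τ, geodesicDir, geodesicDenom]
    simp only [ha, this, h0]
    exact hn
  have ha1 (t : ℝ) : a t = 1 := by
    have := eq_zero_of_hasDerivAt_mul (u := fun s => 1 - a s)
      (k := fun s => -(f (γ s) * (1 + a s))) (hfc.mul (continuous_const.add hac)).neg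
      (fun s => ((had s).const_sub 1).congr_deriv (by ring)) (by simp [ha0]) t
    linarith
  have := sq_eq_one_of_riccati (g := fun t => f (γ t))
    (fun t => (hfd t).congr_deriv (by rw [ha1, mul_one])) (fun t => hV.scalar_ne_zero _ (hmem t))
  simpa [h0] using this

theorem scalar_eq {p : E3} (hp : p ∈ hyp) : f p = f vert := by
  have hconv : Convex ℝ hyp :=
    convex_halfSpace_gt (EuclideanSpace.proj (2 : Fin 3) : E3 →L[ℝ] ℝ).isLinear 0
  rcases hconv.isPreconnected.eq_one_or_eq_neg_one_of_sq_eq hV.contDiffOn_scalar.continuousOn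
    (fun q hq => hV.scalar_sq_eq_one hq) with h | h
  · rw [h hp, h vert_mem_hyp]; rfl
  · rw [h hp, h vert_mem_hyp]; rfl

end IsUnitAntiTorqued

/-! ### Charts, curves and differentials -/

section Charts

variable {N : Type*} [TopologicalSpace N] [ChartedSpace E2 N]

/-- The differential of a real function on a surface. -/
def scalarDiff (W : N → ℝ) (p : N) : TangentSpace (𝓡 2) p →L[ℝ] ℝ := mfderiv (𝓡 2) 𝓘(ℝ, ℝ) W p

/-- The differential of the inverse of a chart. -/
def chartDeriv (c : OpenPartialHomeomorph N E2) (x : E2) : E2 →L[ℝ] TangentSpace (𝓡 2) (c.symm x) :=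
  mfderiv (𝓡 2) (𝓡 2) c.symm x

theorem contDiffOn_comp_chart_symm {F : Type*} [NormedAddCommGroup F] [NormedSpace ℝ F]
    {c : OpenPartialHomeomorph N E2} (hc : c ∈ IsManifold.maximalAtlas (𝓡 2) ∞ N) {W : N → F}
    (hW : ContMDiff (𝓡 2) 𝓘(ℝ, F) ∞ W) : ContDiffOn ℝ ∞ (fun x => W (c.symm x)) c.target :=
  (hW.comp_contMDiffOn (contMDiffOn_symm_of_mem_maximalAtlas hc)).contDiffOn

theorem mdifferentiable_of_mem_maximalAtlas {c : OpenPartialHomeomorph N E2}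
    (hc : c ∈ IsManifold.maximalAtlas (𝓡 2) ∞ N) : c.MDifferentiable (𝓡 2) (𝓡 2) :=
  ⟨(contMDiffOn_of_mem_maximalAtlas hc).mdifferentiableOn (by simp),
    (contMDiffOn_symm_of_mem_maximalAtlas hc).mdifferentiableOn (by simp)⟩

section

variable {c : OpenPartialHomeomorph N E2} (hc : c ∈ IsManifold.maximalAtlas (𝓡 2) ∞ N) {x : E2}
  (hx : x ∈ c.target)
include hc hx

theorem hasFDerivAt_diff_comp {W : N → E3} (hW : MDifferentiableAt (𝓡 2) 𝓘(ℝ, E3) W (c.symm x)) :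
    HasFDerivAt (fun y => W (c.symm y)) ((diff W (c.symm x)).comp (chartDeriv c x)) x :=
  (hW.hasMFDerivAt.comp x
    ((mdifferentiable_of_mem_maximalAtlas hc).symm.mdifferentiableAt hx).hasMFDerivAt).hasFDerivAt

theorem hasFDerivAt_scalarDiff_comp {W : N → ℝ}
    (hW : MDifferentiableAt (𝓡 2) 𝓘(ℝ, ℝ) W (c.symm x)) :
    HasFDerivAt (fun y => W (c.symm y)) ((scalarDiff W (c.symm x)).comp (chartDeriv c x)) x :=
  (hW.hasMFDerivAt.comp x
    ((mdifferentiable_of_mem_maximalAtlas hc).symm.mdifferentiableAt hx).hasMFDerivAt).hasFDerivAt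

theorem chartDeriv_surjective : Function.Surjective (chartDeriv c x) :=
  (mdifferentiable_of_mem_maximalAtlas hc).symm.mfderiv_surjective hx

theorem chartDeriv_injective : Function.Injective (chartDeriv c x) :=
  (mdifferentiable_of_mem_maximalAtlas hc).symm.mfderiv_injective hx

end

theorem hasDerivAt_line {F : Type*} [NormedAddCommGroup F] [NormedSpace ℝ F] (x v : F) :
    HasDerivAt (fun t : ℝ => x + t • v) v 0 := by
  simpa using ((hasDerivAt_id (0 : ℝ)).smul_const v).const_add x

variable [IsManifold (𝓡 2) ∞ N]

/-- Every point is of the form `c.symm x` for some chart `c`. -/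
theorem exists_chart (p : N) : ∃ c ∈ IsManifold.maximalAtlas (𝓡 2) ∞ N, ∃ x ∈ c.target,
    c.symm x = p :=
  ⟨chartAt E2 p, IsManifold.chart_mem_maximalAtlas p, chartAt E2 p p,
    (chartAt E2 p).map_source (mem_chart_source E2 p),
    (chartAt E2 p).left_inv (mem_chart_source E2 p)⟩

/-- Every tangent vector is represented by a curve. -/
theorem exists_curve (p : N) (X : TangentSpace (𝓡 2) p) : ∃ σ : ℝ → N, σ 0 = p ∧
    (∀ {W : N → E3}, MDifferentiableAt (𝓡 2) 𝓘(ℝ, E3) W p →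
      HasDerivAt (fun t => W (σ t)) (diff W p X) 0) ∧
    (∀ {W : N → ℝ}, MDifferentiableAt (𝓡 2) 𝓘(ℝ, ℝ) W p →
      HasDerivAt (fun t => W (σ t)) (scalarDiff W p X) 0) := by
  obtain ⟨c, hc, x, hx, rfl⟩ := exists_chart p
  obtain ⟨v, rfl⟩ := chartDeriv_surjective hc hx X
  refine ⟨fun t => c.symm (x + t • v), by simp, fun hW => ?_, fun hW => ?_⟩
  · exact (hasFDerivAt_diff_comp hc hx hW).comp_hasDerivAt_of_eq 0 (hasDerivAt_line x v) (by simp)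
  · exact (hasFDerivAt_scalarDiff_comp hc hx hW).comp_hasDerivAt_of_eq 0 (hasDerivAt_line x v)
      (by simp)

end Charts

theorem eq_zero_of_inner_orthonormal {a b w z : E3} (haa : inner ℝ a a = (1 : ℝ))
    (hbb : inner ℝ b b = (1 : ℝ)) (hww : inner ℝ w w = (1 : ℝ)) (hab : inner ℝ a b = (0 : ℝ))
    (haw : inner ℝ a w = (0 : ℝ)) (hbw : inner ℝ b w = (0 : ℝ)) (ha : inner ℝ a z = (0 : ℝ))
    (hb : inner ℝ b z = (0 : ℝ)) (hw : inner ℝ w z = (0 : ℝ)) : z = 0 := by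
  have ho : Orthonormal ℝ ![a, b, w] := by
    rw [orthonormal_iff_ite]
    have hba : inner ℝ b a = (0 : ℝ) := by rw [real_inner_comm, hab]
    have hwa : inner ℝ w a = (0 : ℝ) := by rw [real_inner_comm, haw]
    have hwb : inner ℝ w b = (0 : ℝ) := by rw [real_inner_comm, hbw]
    intro i j
    fin_cases i <;> fin_cases j <;> simp [haa, hbb, hww, hab, haw, hbw, hba, hwa, hwb,
      -inner_self_eq_norm_sq_to_K]
  have hcard : Fintype.card (Fin 3) = Module.finrank ℝ E3 := by
    rw [finrank_euclideanSpace_fin, Fintype.card_fin]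
  refine InnerProductSpace.ext_inner_left_basis (basisOfOrthonormalOfCardEqFinrank ho hcard) fun i => ?_
  rw [coe_basisOfOrthonormalOfCardEqFinrank, inner_zero_right]
  fin_cases i <;> simp [ha, hb, hw]

/-! ### The Euclidean unit normal of a surface -/

section Surface

variable {N : Type*} [TopologicalSpace N] [ChartedSpace E2 N]

/-- The normal field `U`, rescaled to have Euclidean length one. -/
def euclidNormal (φ U : N → E3) (p : N) : E3 := (φ p 2)⁻¹ • U p

namespace IsOrientedSurface

variable {φ U : N → E3} (h : IsOrientedSurface φ U)
include h

theorem height_pos (p : N) : 0 < φ p 2 := h.mem_hyp p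

theorem height_ne_zero (p : N) : φ p 2 ≠ 0 := (h.height_pos p).ne'

theorem smul_euclidNormal (p : N) : φ p 2 • euclidNormal φ U p = U p := by
  simp [euclidNormal, smul_smul, h.height_ne_zero p]

theorem contMDiff_height : ContMDiff (𝓡 2) 𝓘(ℝ, ℝ) ∞ fun p => φ p 2 :=
  contDiff_height.comp_contMDiff h.smooth

theorem contMDiff_euclidNormal : ContMDiff (𝓡 2) 𝓘(ℝ, E3) ∞ (euclidNormal φ U) := fun p => by
  have h1 : ContMDiffAt (𝓡 2) 𝓘(ℝ, ℝ) ∞ (fun q => (φ q 2)⁻¹) p :=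
    ContDiffAt.comp_contMDiffAt (g := fun r : ℝ => r⁻¹) (f := fun q => φ q 2)
      (contDiffAt_inv ℝ (h.height_ne_zero p)) (h.contMDiff_height p)
  exact h1.smul (h.smooth_normal p)

theorem inner_euclidNormal (p : N) :
    inner ℝ (euclidNormal φ U p) (euclidNormal φ U p) = (1 : ℝ) := by
  rw [← hypInner_smul_smul (h.mem_hyp p), h.smul_euclidNormal, h.unit]

theorem inner_euclidNormal_diff (p : N) (X : TangentSpace (𝓡 2) p) :
    inner ℝ (euclidNormal φ U p) (diff φ p X) = (0 : ℝ) := by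
  have h1 := h.normal p X
  rw [← h.smul_euclidNormal, hypInner, real_inner_smul_left] at h1
  have := h.height_ne_zero p
  field_simp at h1
  simpa using h1

theorem mdifferentiableAt (p : N) : MDifferentiableAt (𝓡 2) 𝓘(ℝ, E3) φ p :=
  (h.smooth p).mdifferentiableAt (by simp)

theorem mdifferentiableAt_euclidNormal (p : N) :
    MDifferentiableAt (𝓡 2) 𝓘(ℝ, E3) (euclidNormal φ U) p :=
  (h.contMDiff_euclidNormal p).mdifferentiableAt (by simp)

variable [IsManifold (𝓡 2) ∞ N]

theorem inner_euclidNormal_diff_euclidNormal (p : N) (X : TangentSpace (𝓡 2) p) :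
    inner ℝ (euclidNormal φ U p) (diff (euclidNormal φ U) p X) = (0 : ℝ) := by
  obtain ⟨σ, hσ, hd, -⟩ := exists_curve p X
  have h1 := hd (h.mdifferentiableAt_euclidNormal p)
  have h2 := (h1.inner ℝ h1).unique
    ((hasDerivAt_const (0 : ℝ) (1 : ℝ)).congr_of_eventuallyEq
      (.of_forall fun t => h.inner_euclidNormal (σ t)))
  rw [hσ, real_inner_comm] at h2
  rw [real_inner_comm]
  linarith

theorem diff_normal (p : N) (X : TangentSpace (𝓡 2) p) : diff U p X =
    φ p 2 • diff (euclidNormal φ U) p X + (diff φ p X) 2 • euclidNormal φ U p := by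
  obtain ⟨σ, hσ, hd, -⟩ := exists_curve p X
  have h1 := hd (h.mdifferentiableAt_euclidNormal p)
  have h2 := hasDerivAt_height (hd (h.mdifferentiableAt p))
  have h3 := hd ((h.smooth_normal p).mdifferentiableAt (by simp))
  have h4 := h3.unique ((h2.fun_smul h1).congr_of_eventuallyEq
      (.of_forall fun t => (h.smul_euclidNormal (σ t)).symm))
  rw [hσ] at h4
  exact h4

/-- Under the conformal change the shape operator is rescaled and shifted by a multiple of the
identity. So A and dν have the same eigenvectors, and A-eigenvalue k corresponds to x₃ dν = (ν₃ - k)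
dφ. -/
theorem diff_shapeOperator_eq (p : N) (X : TangentSpace (𝓡 2) p) :
    diff φ p (shapeOperator φ U p X) =
      euclidNormal φ U p 2 • diff φ p X - φ p 2 • diff (euclidNormal φ U) p X := by
  rw [diff_shapeOperator φ U h]
  change -(diff U p X + christoffel (φ p) (diff φ p X) (U p)) = _
  rw [h.diff_normal p X, ← h.smul_euclidNormal, christoffel, real_inner_smul_right,
    real_inner_comm, h.inner_euclidNormal_diff]
  have := h.height_ne_zero p
  simp only [PiLp.smul_apply, smul_eq_mul]
  match_scalars <;> field_simp <;> ring

/-- The second fundamental form is symmetric. -/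
theorem inner_diff_euclidNormal_comm (p : N) (X Y : TangentSpace (𝓡 2) p) :
    (inner ℝ (diff (euclidNormal φ U) p X) (diff φ p Y) : ℝ) =
      inner ℝ (diff (euclidNormal φ U) p Y) (diff φ p X) := by
  obtain ⟨c, hc, x, hx, rfl⟩ := exists_chart p
  obtain ⟨v, rfl⟩ := chartDeriv_surjective hc hx X
  obtain ⟨w, rfl⟩ := chartDeriv_surjective hc hx Y
  set ψ := fun y => φ (c.symm y) with hψ
  have hψd {y : E2} (hy : y ∈ c.target) (u : E2) :
      fderiv ℝ ψ y u = diff φ (c.symm y) (chartDeriv c y u) := by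
    rw [(hasFDerivAt_diff_comp hc hy (h.mdifferentiableAt _)).fderiv]; rfl
  have hsm : ContDiffAt ℝ ∞ ψ x :=
    (contDiffOn_comp_chart_symm hc h.smooth).contDiffAt (c.open_target.mem_nhds hx)
  have hsym : IsSymmSndFDerivAt ℝ ψ x := hsm.isSymmSndFDerivAt
    (by rw [minSmoothness_of_isRCLikeNormedField]; exact WithTop.coe_le_coe.2 (le_top (a := 2)))
  have h2 : HasFDerivAt (fderiv ℝ ψ) (fderiv ℝ (fderiv ℝ ψ) x) x :=
    ((hsm.fderiv_right (m := 1) (by norm_cast)).differentiableAt (by simp)).hasFDerivAt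
  -- Differentiating ⟨ν, dψ(u')⟩ = 0 along u expresses the form through the symmetric second
  -- derivative of ψ.
  have key (u u' : E2) : (inner ℝ (diff (euclidNormal φ U) (c.symm x) (chartDeriv c x u))
      (diff φ (c.symm x) (chartDeriv c x u')) : ℝ)
      = -inner ℝ (euclidNormal φ U (c.symm x)) (fderiv ℝ (fderiv ℝ ψ) x u u') := by
    have hγ := hasDerivAt_line x u
    have hx0 : x + (0 : ℝ) • u = x := by simp
    have a1 : HasDerivAt (fun t : ℝ => euclidNormal φ U (c.symm (x + t • u)))
        (diff (euclidNormal φ U) (c.symm x) (chartDeriv c x u)) 0 :=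
      (hasFDerivAt_diff_comp hc hx (h.mdifferentiableAt_euclidNormal _)).comp_hasDerivAt_of_eq 0 hγ
        hx0.symm
    have a2 : HasDerivAt (fun t : ℝ => fderiv ℝ ψ (x + t • u)) (fderiv ℝ (fderiv ℝ ψ) x u) 0 :=
      h2.comp_hasDerivAt_of_eq 0 hγ hx0.symm
    have a3 := (a1.inner ℝ (a2.clm_apply (hasDerivAt_const (0 : ℝ) u'))).unique
      ((hasDerivAt_const (0 : ℝ) (0 : ℝ)).congr_of_eventuallyEq (by
        filter_upwards [hγ.continuousAt.preimage_mem_nhds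
          (c.open_target.mem_nhds (by rwa [hx0]))] with t ht
        rw [hψd ht]
        exact h.inner_euclidNormal_diff _ _))
    simp only [map_zero, add_zero, hx0, hψd hx] at a3
    linarith
  rw [key, key, hsym.eq]

end IsOrientedSurface

end Surface

/-! ### Principal curvatures of constant angle surfaces -/

section ConstantAngleSurface

variable {N : Type*} [TopologicalSpace N] [ChartedSpace E2 N]

theorem diff_pullVec {φ U : N → E3} (h : IsOrientedSurface φ U) (p : N) {w : E3}
    (hw : inner ℝ w (euclidNormal φ U p) = (0 : ℝ)) : diff φ p (pullVec φ p w) = w := by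
  obtain ⟨Y, rfl⟩ := mem_range_diff_of_orthogonal φ U h p w (by
    rw [← h.smul_euclidNormal, hypInner_smul_right (h.mem_hyp p), hw, zero_div])
  exact congrArg (diff φ p)
    (LinearMap.leftInverse_apply_of_inj (LinearMap.ker_eq_bot.2 (h.immersion p)) Y)

/-- The Euclidean unit vector in the direction of the tangential part of the axis. -/
def tangentDir (φ U : N → E3) (V : E3 → E3) (θ : ℝ) (p : N) : E3 :=
  (Real.sin θ)⁻¹ • (euclidUnit V (φ p) - Real.cos θ • euclidNormal φ U p)

namespace IsConstantAngleSurface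

variable {φ U : N → E3} {V : E3 → E3} {θ : ℝ} {f : E3 → ℝ}
  (hN : IsConstantAngleSurface φ U V θ) (hV : IsUnitAntiTorqued V f)
include hN

theorem inner_euclidNormal_euclidUnit (p : N) :
    inner ℝ (euclidNormal φ U p) (euclidUnit V (φ p)) = Real.cos θ := by
  rw [← hypInner_smul_smul (hN.surface.mem_hyp p), hN.surface.smul_euclidNormal,
    smul_euclidUnit (hN.surface.mem_hyp p), hN.angle]

theorem diff_tangentPart (p : N) : diff φ p (tangentPart φ U V p) =
    φ p 2 • (euclidUnit V (φ p) - Real.cos θ • euclidNormal φ U p) := by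
  have h1 : V (φ p) - hypInner (φ p) (V (φ p)) (U p) • U p =
      φ p 2 • (euclidUnit V (φ p) - Real.cos θ • euclidNormal φ U p) := by
    have h2 : hypInner (φ p) (V (φ p)) (U p) = Real.cos θ := by
      rw [← hN.angle p, hypInner, hypInner, real_inner_comm]
    rw [h2, ← hN.surface.smul_euclidNormal p, ← smul_euclidUnit (V := V) (hN.surface.mem_hyp p)]
    module
  rw [tangentPart, h1]
  apply diff_pullVec hN.surface
  rw [real_inner_smul_left, inner_sub_left, real_inner_smul_left, hN.surface.inner_euclidNormal,
    real_inner_comm, hN.inner_euclidNormal_euclidUnit]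
  ring

include hV

theorem inner_sub_self (p : N) :
    inner ℝ (euclidUnit V (φ p) - Real.cos θ • euclidNormal φ U p)
      (euclidUnit V (φ p) - Real.cos θ • euclidNormal φ U p) = Real.sin θ ^ 2 := by
  simp only [inner_sub_left, inner_sub_right, real_inner_smul_left, real_inner_smul_right,
    hN.inner_euclidNormal_euclidUnit, hN.surface.inner_euclidNormal,
    hV.inner_euclidUnit (hN.surface.mem_hyp p), real_inner_comm (euclidNormal φ U p)]
  rw [Real.sin_sq]; ring

/-- The tangential part of V has length sin θ, and it is assumed nonzero. A point of N is needed for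
this to constrain θ. -/
theorem sin_pos [Nonempty N] : 0 < Real.sin θ := by
  obtain ⟨p⟩ := ‹Nonempty N›
  refine lt_of_le_of_ne (Real.sin_nonneg_of_mem_Icc hN.angle_mem) fun h0 => ?_
  have h1 := hN.inner_sub_self hV p
  rw [← h0, zero_pow two_ne_zero, inner_self_eq_zero] at h1
  have h2 := hN.diff_tangentPart p
  rw [h1, smul_zero] at h2
  exact hN.tangentPart_ne_zero p (hN.surface.immersion p (h2.trans (map_zero _).symm))

theorem diff_unitTangentPart (p : N) :
    diff φ p (unitTangentPart φ U V p) = φ p 2 • tangentDir φ U V θ p := by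
  have : Nonempty N := ⟨p⟩
  have hs := hN.sin_pos hV
  have h1 : inducedInner φ p (tangentPart φ U V p) (tangentPart φ U V p) = Real.sin θ ^ 2 := by
    rw [inducedInner, hN.diff_tangentPart, hypInner_smul_smul (hN.surface.mem_hyp p),
      hN.inner_sub_self hV]
  rw [unitTangentPart, h1, Real.sqrt_sq hs.le, map_smul, hN.diff_tangentPart, tangentDir,
    smul_comm]

theorem inner_tangentDir (p : N) :
    inner ℝ (tangentDir φ U V θ p) (tangentDir φ U V θ p) = (1 : ℝ) := by
  have : Nonempty N := ⟨p⟩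
  have hs := (hN.sin_pos hV).ne'
  rw [tangentDir, real_inner_smul_left, real_inner_smul_right, hN.inner_sub_self hV]
  field_simp

omit hV in
theorem inner_euclidNormal_tangentDir (p : N) :
    inner ℝ (euclidNormal φ U p) (tangentDir φ U V θ p) = (0 : ℝ) := by
  rw [tangentDir, real_inner_smul_right, inner_sub_right, real_inner_smul_right,
    hN.surface.inner_euclidNormal, hN.inner_euclidNormal_euclidUnit]
  ring

omit hV in
theorem inner_tangentDir_diff (p : N) (X : TangentSpace (𝓡 2) p) :
    inner ℝ (tangentDir φ U V θ p) (diff φ p X) =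
      (Real.sin θ)⁻¹ * inner ℝ (diff φ p X) (euclidUnit V (φ p)) := by
  rw [tangentDir, real_inner_smul_left, inner_sub_left, real_inner_smul_left,
    hN.surface.inner_euclidNormal_diff, real_inner_comm]
  ring

theorem inducedInner_unitTangentPart (p : N) (X : TangentSpace (𝓡 2) p) :
    inducedInner φ p (unitTangentPart φ U V p) X =
      (Real.sin θ)⁻¹ * inner ℝ (diff φ p X) (euclidUnit V (φ p)) / φ p 2 := by
  have := hN.surface.height_ne_zero p
  rw [inducedInner, hN.diff_unitTangentPart hV, ← hN.inner_tangentDir_diff, hypInner,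
    real_inner_smul_left]
  field_simp

theorem inducedInner_unitTangentPart_self (p : N) :
    inducedInner φ p (unitTangentPart φ U V p) (unitTangentPart φ U V p) = 1 := by
  rw [inducedInner, hN.diff_unitTangentPart hV, hypInner_smul_smul (hN.surface.mem_hyp p),
    hN.inner_tangentDir hV]

/-- In Euclidean terms ν, `tangentDir` and w are orthonormal; e is the hyperbolic unit vector
tangent to N in the direction w, orthogonal to T. -/
theorem exists_frame (p : N) : ∃ (w : E3) (e : TangentSpace (𝓡 2) p),
    inner ℝ w w = (1 : ℝ) ∧ inner ℝ w (euclidNormal φ U p) = (0 : ℝ) ∧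
    inner ℝ w (euclidUnit V (φ p)) = (0 : ℝ) ∧ diff φ p e = φ p 2 • w ∧
    ∀ z : E3, inner ℝ (euclidNormal φ U p) z = (0 : ℝ) →
      z = (inner ℝ (tangentDir φ U V θ p) z : ℝ) • tangentDir φ U V θ p +
        (inner ℝ w z : ℝ) • w := by
  obtain ⟨w, hww, hwν, hwn⟩ := exists_unit_orthogonal (euclidNormal φ U p) (euclidUnit V (φ p))
  have hwm : inner ℝ w (tangentDir φ U V θ p) = (0 : ℝ) := by
    rw [tangentDir, real_inner_smul_right, inner_sub_right, real_inner_smul_right, hwν, hwn]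
    ring
  refine ⟨w, pullVec φ p (φ p 2 • w), hww, hwν, hwn,
    diff_pullVec hN.surface p (by rw [real_inner_smul_left, hwν, mul_zero]), fun z hz => ?_⟩
  have hmw : inner ℝ (tangentDir φ U V θ p) w = (0 : ℝ) := by rw [real_inner_comm]; exact hwm
  have hνw : inner ℝ (euclidNormal φ U p) w = (0 : ℝ) := by rw [real_inner_comm]; exact hwν
  have hνm := hN.inner_euclidNormal_tangentDir p
  have hmm := hN.inner_tangentDir hV p
  rw [← sub_eq_zero]
  refine eq_zero_of_inner_orthonormal (hN.surface.inner_euclidNormal p) hmm hww hνm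
    hνw hmw ?_ ?_ ?_ <;>
  simp only [inner_sub_right, inner_add_right, real_inner_smul_right, hz, hνm, hνw, hmm, hmw, hww,
    hwm] <;> ring

variable [IsManifold (𝓡 2) ∞ N]

/-- The derivative of the constant angle condition. Through `diff_shapeOperator_eq` it says ⟨AX,V⟩ =
-f cos θ ⟨X,V⟩. -/
theorem inner_diff_euclidNormal_euclidUnit (p : N) (X : TangentSpace (𝓡 2) p) :
    φ p 2 * inner ℝ (diff (euclidNormal φ U) p X) (euclidUnit V (φ p)) =
      (euclidNormal φ U p 2 + Real.cos θ * f vert) *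
        inner ℝ (diff φ p X) (euclidUnit V (φ p)) := by
  have hp := hN.surface.mem_hyp p
  obtain ⟨σ, hσ, hd, -⟩ := exists_curve p X
  have h1 := hd (hN.surface.mdifferentiableAt_euclidNormal p)
  have h2 := (hV.hasFDerivAt_euclidUnit hp).comp_hasDerivAt_of_eq 0
    (hd (hN.surface.mdifferentiableAt p)) (by rw [hσ])
  have h3 := (h1.inner ℝ h2).unique
    ((hasDerivAt_const (0 : ℝ) (Real.cos θ)).congr_of_eventuallyEq
      (.of_forall fun t => hN.inner_euclidNormal_euclidUnit (σ t)))
  simp only [Function.comp, hσ] at h3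
  have h4 := congrArg (fun z : E3 => (inner ℝ (euclidNormal φ U p) z : ℝ))
    (hV.fderiv_euclidUnit hp (diff φ p X))
  simp only [inner_sub_right, inner_add_right, real_inner_smul_right,
    hN.surface.inner_euclidNormal_diff, hN.inner_euclidNormal_euclidUnit, inner_vert_right,
    hV.scalar_eq hp] at h4
  linear_combination (φ p 2) * h3 - h4

/-- The direction of the tangential part of the axis is principal. -/
theorem smul_diff_euclidNormal_unitTangentPart (p : N) :
    φ p 2 • diff (euclidNormal φ U) p (unitTangentPart φ U V p) =
      (euclidNormal φ U p 2 + Real.cos θ * f vert) • diff φ p (unitTangentPart φ U V p) := by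
  have h := hN.surface
  set T := unitTangentPart φ U V p
  set Z := φ p 2 • diff (euclidNormal φ U) p T -
    (euclidNormal φ U p 2 + Real.cos θ * f vert) • diff φ p T with hZ
  have horth (Y : TangentSpace (𝓡 2) p) : inner ℝ Z (diff φ p Y) = (0 : ℝ) := by
    have e0 := hN.diff_unitTangentPart hV p
    have e1 : (inner ℝ (diff (euclidNormal φ U) p Y) (tangentDir φ U V θ p) : ℝ) =
        (Real.sin θ)⁻¹ * inner ℝ (diff (euclidNormal φ U) p Y) (euclidUnit V (φ p)) := by
      rw [tangentDir, real_inner_smul_right, inner_sub_right, real_inner_smul_right,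
        real_inner_comm (euclidNormal φ U p), h.inner_euclidNormal_diff_euclidNormal]
      ring
    rw [hZ, inner_sub_left, real_inner_smul_left, real_inner_smul_left,
      h.inner_diff_euclidNormal_comm, e0, real_inner_smul_right, real_inner_smul_left, e1,
      hN.inner_tangentDir_diff]
    linear_combination (φ p 2) * (Real.sin θ)⁻¹ * hN.inner_diff_euclidNormal_euclidUnit hV p Y
  have hν : inner ℝ Z (euclidNormal φ U p) = (0 : ℝ) := by
    rw [real_inner_comm, hZ, inner_sub_right, real_inner_smul_right, real_inner_smul_right,
      h.inner_euclidNormal_diff_euclidNormal, h.inner_euclidNormal_diff]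
    ring
  -- Z is orthogonal to ν, hence tangent, and it is orthogonal to every tangent vector; so ⟨Z,Z⟩ =
  -- 0.
  have := horth (pullVec φ p Z)
  rw [diff_pullVec h p hν, inner_self_eq_zero] at this
  exact sub_eq_zero.1 this

/-- The tangent directions orthogonal to the axis are principal. -/
theorem exists_secondCurvature (p : N) : ∃ k : ℝ, ∀ X : TangentSpace (𝓡 2) p,
    inner ℝ (diff φ p X) (euclidUnit V (φ p)) = (0 : ℝ) →
      φ p 2 • diff (euclidNormal φ U) p X = (euclidNormal φ U p 2 - k) • diff φ p X := by
  have h := hN.surface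
  have hy := h.height_ne_zero p
  obtain ⟨w, e, hww, hwν, hwn, he, hz⟩ := hN.exists_frame hV p
  have h1 : diff (euclidNormal φ U) p e =
      (inner ℝ w (diff (euclidNormal φ U) p e) : ℝ) • w := by
    have h2 := hz _ (h.inner_euclidNormal_diff_euclidNormal p e)
    have h3 := hN.inner_diff_euclidNormal_euclidUnit hV p e
    rw [he, real_inner_smul_left, hwn] at h3
    have h4 : inner ℝ (tangentDir φ U V θ p) (diff (euclidNormal φ U) p e) = (0 : ℝ) := by
      rw [tangentDir, real_inner_smul_left, inner_sub_left, real_inner_smul_left,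
        h.inner_euclidNormal_diff_euclidNormal, real_inner_comm]
      simp only [mul_zero, mul_eq_zero, hy, false_or] at h3
      rw [h3]; ring
    rwa [h4, zero_smul, zero_add] at h2
  set b : ℝ := inner ℝ w (diff (euclidNormal φ U) p e)
  refine ⟨euclidNormal φ U p 2 - b, fun X hX => ?_⟩
  have h5 := hz _ (h.inner_euclidNormal_diff p X)
  rw [hN.inner_tangentDir_diff, hX, mul_zero, zero_smul, zero_add] at h5
  set a : ℝ := inner ℝ w (diff φ p X)
  have h6 : X = (a / φ p 2) • e := by
    apply h.immersion p
    rw [map_smul, he, h5, smul_smul, div_mul_cancel₀ _ hy]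
  rw [h6, map_smul, map_smul, he, h1]
  match_scalars
  ring

variable {κ : N → ℝ} (hκ : ∀ (p : N) (X : TangentSpace (𝓡 2) p),
    inner ℝ (diff φ p X) (euclidUnit V (φ p)) = (0 : ℝ) →
      φ p 2 • diff (euclidNormal φ U) p X = (euclidNormal φ U p 2 - κ p) • diff φ p X)
include hκ

theorem exists_principal (p : N) : ∃ e : TangentSpace (𝓡 2) p,
    inducedInner φ p (unitTangentPart φ U V p) (unitTangentPart φ U V p) = 1 ∧
    inducedInner φ p (unitTangentPart φ U V p) e = 0 ∧
    inducedInner φ p e e = 1 ∧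
    shapeOperator φ U p (unitTangentPart φ U V p) =
      (-Real.cos θ * f vert) • unitTangentPart φ U V p ∧
    shapeOperator φ U p e = κ p • e := by
  have h := hN.surface
  obtain ⟨w, e, hww, hwν, hwn, he, hz⟩ := hN.exists_frame hV p
  have hen : inner ℝ (diff φ p e) (euclidUnit V (φ p)) = (0 : ℝ) := by
    rw [he, real_inner_smul_left, hwn, mul_zero]
  refine ⟨e, hN.inducedInner_unitTangentPart_self hV p, ?_, ?_, ?_, ?_⟩
  · rw [hN.inducedInner_unitTangentPart hV, hen]; ring
  · rw [inducedInner, he, hypInner_smul_smul (h.mem_hyp p), hww]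
  · apply h.immersion p
    rw [h.diff_shapeOperator_eq, hN.smul_diff_euclidNormal_unitTangentPart hV, map_smul]
    module
  · apply h.immersion p
    rw [h.diff_shapeOperator_eq, hκ p e hen, map_smul]
    module

end IsConstantAngleSurface

end ConstantAngleSurface

/-! ### Smoothness of the second principal curvature and its evolution along `T` -/

section SecondCurvature

variable {N : Type*} [TopologicalSpace N] [ChartedSpace E2 N]

theorem contMDiff_of_chart [IsManifold (𝓡 2) ∞ N] {W : N → ℝ}
    (hW : ∀ c ∈ IsManifold.maximalAtlas (𝓡 2) ∞ N,
      ContDiffOn ℝ ∞ (fun x => W (c.symm x)) c.target) :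
    ContMDiff (𝓡 2) 𝓘(ℝ, ℝ) ∞ W := fun p => by
  set c := chartAt E2 p
  have hc : c ∈ IsManifold.maximalAtlas (𝓡 2) ∞ N := IsManifold.chart_mem_maximalAtlas p
  have hp : p ∈ c.source := mem_chart_source E2 p
  have h1 : ContMDiffAt (𝓡 2) (𝓡 2) ∞ c p := contMDiffAt_of_mem_maximalAtlas hc hp
  have h2 := ((hW c hc).contDiffAt (c.open_target.mem_nhds (c.map_source hp))).comp_contMDiffAt h1
  refine h2.congr_of_eventuallyEq ?_
  filter_upwards [c.open_source.mem_nhds hp] with q hq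
  simp [c.left_inv hq]

theorem eq_add_smul_single (v : E2) : v = v 0 • EuclideanSpace.single 0 (1 : ℝ) +
    v 1 • EuclideanSpace.single 1 (1 : ℝ) := by
  ext i; fin_cases i <;> simp

namespace IsConstantAngleSurface

variable {φ U : N → E3} {V : E3 → E3} {θ : ℝ} {f : E3 → ℝ}
  (hN : IsConstantAngleSurface φ U V θ) (hV : IsUnitAntiTorqued V f)
include hN hV

theorem contMDiff_euclidUnit : ContMDiff (𝓡 2) 𝓘(ℝ, E3) ∞ fun p => euclidUnit V (φ p) := fun p =>
  (hV.contDiffAt_euclidUnit (hN.surface.mem_hyp p)).comp_contMDiffAt (hN.surface.smooth p)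

theorem contMDiff_tangentDir : ContMDiff (𝓡 2) 𝓘(ℝ, E3) ∞ (tangentDir φ U V θ) := by
  have h : ContDiff ℝ ∞ fun q : E3 × E3 => (Real.sin θ)⁻¹ • (q.1 - Real.cos θ • q.2) := by
    fun_prop
  exact h.comp_contMDiff
    ((hN.contMDiff_euclidUnit hV).prodMk_space hN.surface.contMDiff_euclidNormal)

variable [IsManifold (𝓡 2) ∞ N] {κ : N → ℝ}
  (hκ : ∀ (p : N) (X : TangentSpace (𝓡 2) p),
    inner ℝ (diff φ p X) (euclidUnit V (φ p)) = (0 : ℝ) →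
      φ p 2 • diff (euclidNormal φ U) p X = (euclidNormal φ U p 2 - κ p) • diff φ p X)
include hκ

/-- Splitting X into its T-part and the rest evaluates the second fundamental form without a frame.
The result is linear in κ with coefficients that are smooth in a chart, which is how κ is shown to
be smooth. -/
theorem inner_diff_euclidNormal_diff (p : N) (X : TangentSpace (𝓡 2) p) :
    φ p 2 * inner ℝ (diff (euclidNormal φ U) p X) (diff φ p X) =
      (euclidNormal φ U p 2 + Real.cos θ * f vert) *
        inner ℝ (tangentDir φ U V θ p) (diff φ p X) ^ 2 +
      (euclidNormal φ U p 2 - κ p) * (inner ℝ (diff φ p X) (diff φ p X) -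
        inner ℝ (tangentDir φ U V θ p) (diff φ p X) ^ 2) := by
  have : Nonempty N := ⟨p⟩
  have hs := (hN.sin_pos hV).ne'
  have hy := hN.surface.height_ne_zero p
  set m := tangentDir φ U V θ p
  set a : ℝ := inner ℝ m (diff φ p X) with ha
  set T := unitTangentPart φ U V p
  have hT : diff φ p T = φ p 2 • m := hN.diff_unitTangentPart hV p
  obtain ⟨Y, hY⟩ : ∃ Y, X = Y + (a / φ p 2) • T := ⟨X - (a / φ p 2) • T, by module⟩
  have hdX : diff φ p X = diff φ p Y + a • m := by
    rw [hY, map_add, map_smul, hT, smul_smul, div_mul_cancel₀ _ hy]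
  have hmY : inner ℝ m (diff φ p Y) = (0 : ℝ) := by
    rw [hdX, inner_add_right, real_inner_smul_right, hN.inner_tangentDir hV] at ha
    linarith
  have hYn : inner ℝ (diff φ p Y) (euclidUnit V (φ p)) = (0 : ℝ) := by
    have h1 := hN.inner_tangentDir_diff p Y
    rw [hmY] at h1
    simpa [hs] using h1.symm
  have h2 := hκ p Y hYn
  have h3 := hN.smul_diff_euclidNormal_unitTangentPart hV p
  have h4 : φ p 2 • diff (euclidNormal φ U) p X = (euclidNormal φ U p 2 - κ p) • diff φ p Y +
      ((euclidNormal φ U p 2 + Real.cos θ * f vert) * a) • m := by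
    have h5 : φ p 2 • diff (euclidNormal φ U) p X = φ p 2 • diff (euclidNormal φ U) p Y +
        (a / φ p 2) • φ p 2 • diff (euclidNormal φ U) p T := by
      rw [hY, map_add, map_smul]; module
    rw [h5, h2, h3, hT]
    match_scalars <;> field_simp
  rw [← real_inner_smul_left, h4, hdX]
  have hmm := hN.inner_tangentDir hV p
  have hYm : inner ℝ (diff φ p Y) m = (0 : ℝ) := by rw [real_inner_comm]; exact hmY
  simp only [inner_add_left, inner_add_right, real_inner_smul_left, real_inner_smul_right, hmY,
    hYm, m, hmm]
  ring

omit hκ [IsManifold (𝓡 2) ∞ N] in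
-- The denominator in the formula for κ. Each summand is the squared w-component of a coordinate
-- vector, and both cannot vanish because the coordinate vectors span the tangent plane.
theorem sum_transverse_pos {c : OpenPartialHomeomorph N E2}
    (hc : c ∈ IsManifold.maximalAtlas (𝓡 2) ∞ N) {x : E2} (hx : x ∈ c.target) :
    0 < ∑ i : Fin 2, ((inner ℝ
      (diff φ (c.symm x) (chartDeriv c x (EuclideanSpace.single i (1 : ℝ))))
      (diff φ (c.symm x) (chartDeriv c x (EuclideanSpace.single i (1 : ℝ)))) : ℝ) -
      inner ℝ (tangentDir φ U V θ (c.symm x))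
        (diff φ (c.symm x) (chartDeriv c x (EuclideanSpace.single i (1 : ℝ)))) ^ 2) := by
  obtain ⟨w, e, hww, hwν, hwn, he, hz⟩ := hN.exists_frame hV (c.symm x)
  obtain ⟨v, rfl⟩ := chartDeriv_surjective hc hx e
  have hmm := hN.inner_tangentDir hV (c.symm x)
  have hwm : inner ℝ w (tangentDir φ U V θ (c.symm x)) = (0 : ℝ) := by
    rw [tangentDir, real_inner_smul_right, inner_sub_right, real_inner_smul_right, hwν, hwn]
    ring
  have hmw : inner ℝ (tangentDir φ U V θ (c.symm x)) w = (0 : ℝ) := by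
    rw [real_inner_comm]; exact hwm
  set m := tangentDir φ U V θ (c.symm x)
  have key (u : E2) : (inner ℝ (diff φ (c.symm x) (chartDeriv c x u))
      (diff φ (c.symm x) (chartDeriv c x u)) : ℝ) -
      inner ℝ m (diff φ (c.symm x) (chartDeriv c x u)) ^ 2 =
      inner ℝ w (diff φ (c.symm x) (chartDeriv c x u)) ^ 2 := by
    have h1 := hz _ (hN.surface.inner_euclidNormal_diff _ (chartDeriv c x u))
    generalize diff φ (c.symm x) (chartDeriv c x u) = z at h1 ⊢
    have h2 : (inner ℝ z z : ℝ) = inner ℝ m z * inner ℝ z m + inner ℝ w z * inner ℝ z w := by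
      have h3 := congrArg (fun y => (inner ℝ z y : ℝ)) h1
      simpa only [inner_add_right, real_inner_smul_right] using h3
    rw [h2, real_inner_comm m, real_inner_comm w]
    ring
  simp only [key]
  refine lt_of_le_of_ne (Finset.sum_nonneg fun i _ => sq_nonneg _) fun h0 => ?_
  have h3 := (Finset.sum_eq_zero_iff_of_nonneg fun i _ => sq_nonneg _).1 h0.symm
  simp only [Finset.mem_univ, true_implies, pow_eq_zero_iff two_ne_zero] at h3
  have h4 : inner ℝ w (diff φ (c.symm x) (chartDeriv c x v)) = (0 : ℝ) := by
    rw [eq_add_smul_single v]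
    simp only [map_add, map_smul, inner_add_right, real_inner_smul_right, h3]
    ring
  rw [he, real_inner_smul_right, hww, mul_one] at h4
  exact hN.surface.height_ne_zero _ h4

/-- The second principal curvature is smooth. -/
theorem contMDiff_secondCurvature : ContMDiff (𝓡 2) 𝓘(ℝ, ℝ) ∞ κ := by
  refine contMDiff_of_chart fun c hc => ?_
  have hS := hN.surface
  have hψ := contDiffOn_comp_chart_symm hc hS.smooth
  have hν := contDiffOn_comp_chart_symm hc hS.contMDiff_euclidNormal
  have hm := contDiffOn_comp_chart_symm hc (hN.contMDiff_tangentDir hV)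
  have hy : ContDiffOn ℝ ∞ (fun x => φ (c.symm x) 2) c.target := contDiff_height.comp_contDiffOn hψ
  have hν2 : ContDiffOn ℝ ∞ (fun x => euclidNormal φ U (c.symm x) 2) c.target :=
    contDiff_height.comp_contDiffOn hν
  have hF (i : Fin 2) : ContDiffOn ℝ ∞ (fun x => diff φ (c.symm x)
      (chartDeriv c x (EuclideanSpace.single i (1 : ℝ)))) c.target :=
    ((hψ.fderiv_of_isOpen c.open_target le_rfl).clm_apply contDiffOn_const).congr fun x hx => by
      rw [(hasFDerivAt_diff_comp hc hx (hS.mdifferentiableAt _)).fderiv]; rfl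
  have hG (i : Fin 2) : ContDiffOn ℝ ∞ (fun x => diff (euclidNormal φ U) (c.symm x)
      (chartDeriv c x (EuclideanSpace.single i (1 : ℝ)))) c.target :=
    ((hν.fderiv_of_isOpen c.open_target le_rfl).clm_apply contDiffOn_const).congr fun x hx => by
      rw [(hasFDerivAt_diff_comp hc hx (hS.mdifferentiableAt_euclidNormal _)).fderiv]; rfl
  -- A single coordinate vector may be parallel to T, so the linear equation for κ is summed over
  -- both before dividing.
  have hden : ContDiffOn ℝ ∞ _ c.target := ContDiffOn.sum (s := Finset.univ) fun (i : Fin 2) _ =>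
    ((hF i).inner ℝ (hF i)).sub ((hm.inner ℝ (hF i)).pow 2)
  have hnum : ContDiffOn ℝ ∞ _ c.target := ContDiffOn.sum (s := Finset.univ) fun (i : Fin 2) _ =>
    ((hy.mul ((hG i).inner ℝ (hF i))).sub
      ((hν2.add (contDiffOn_const (c := Real.cos θ * f vert))).mul ((hm.inner ℝ (hF i)).pow 2)))
  refine (hν2.sub (hnum.div hden fun x hx => (hN.sum_transverse_pos hV hc hx).ne')).congr
    fun x hx => ?_
  have h1 := (hN.sum_transverse_pos hV hc hx).ne'
  rw [eq_sub_iff_add_eq, ← eq_sub_iff_add_eq']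
  refine (div_eq_iff h1).2 ?_
  rw [Finset.mul_sum]
  refine Finset.sum_congr rfl fun i _ => ?_
  rw [hN.inner_diff_euclidNormal_diff hV hκ]
  ring

/-- The Codazzi equation in an adapted chart. -/
theorem hasLineDerivAt_secondCurvature {c : OpenPartialHomeomorph N E2}
    (hc : IsAdaptedChart φ U V c) {x : E2} (hx : x ∈ c.target) :
    HasLineDerivAt ℝ (fun y => κ (c.symm y))
      (-(Real.sin θ)⁻¹ * (Real.cos θ * f vert + κ (c.symm x)) *
        (Real.cos θ * κ (c.symm x) + f vert)) x (EuclideanSpace.single 0 (1 : ℝ) : E2) := by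
  have : Nonempty N := ⟨c.symm x⟩
  have hs := (hN.sin_pos hV).ne'
  have hS := hN.surface
  have hat := hc.mem_atlas
  set e₀ : E2 := EuclideanSpace.single 0 (1 : ℝ)
  set e₁ : E2 := EuclideanSpace.single 1 (1 : ℝ)
  set ψ : E2 → E3 := fun z => φ (c.symm z)
  set ν : E2 → E3 := fun z => euclidNormal φ U (c.symm z)
  set n : E2 → E3 := fun z => euclidUnit V (φ (c.symm z))
  set k : E2 → ℝ := fun z => κ (c.symm z)
  have hA {z : E2} (hz : z ∈ c.target) (v : E2) :
      diff φ (c.symm z) (chartDeriv c z v) = fderiv ℝ ψ z v := by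
    rw [(hasFDerivAt_diff_comp hat hz (hS.mdifferentiableAt _)).fderiv]; rfl
  have hB {z : E2} (hz : z ∈ c.target) (v : E2) :
      diff (euclidNormal φ U) (c.symm z) (chartDeriv c z v) = fderiv ℝ ν z v := by
    rw [(hasFDerivAt_diff_comp hat hz (hS.mdifferentiableAt_euclidNormal _)).fderiv]; rfl
  have hds {z : E2} (hz : z ∈ c.target) : chartDeriv c z e₀ = unitTangentPart φ U V (c.symm z) :=
    hc.ds_eq z hz
  have hdt {z : E2} (hz : z ∈ c.target) :
      inner ℝ (diff φ (c.symm z) (chartDeriv c z e₁)) (n z) = (0 : ℝ) := by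
    obtain ⟨lam, -, hlam⟩ := hc.metric
    have h1 := (hlam z hz).2.2.1
    change inducedInner φ (c.symm z) (chartDeriv c z e₀) (chartDeriv c z e₁) = 0 at h1
    rw [hds hz, hN.inducedInner_unitTangentPart hV] at h1
    have := hS.height_ne_zero (c.symm z)
    simpa [hs, this] using h1
  have hsψ {z : E2} (hz : z ∈ c.target) :
      fderiv ℝ ψ z e₀ = (Real.sin θ)⁻¹ • ψ z 2 • (n z - Real.cos θ • ν z) := by
    rw [← hA hz, hds hz, hN.diff_unitTangentPart hV, tangentDir, smul_comm]
  have hsν {z : E2} (hz : z ∈ c.target) :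
      ψ z 2 • fderiv ℝ ν z e₀ = (ν z 2 + Real.cos θ * f vert) • fderiv ℝ ψ z e₀ := by
    rw [← hA hz, ← hB hz, hds hz]
    exact hN.smul_diff_euclidNormal_unitTangentPart hV _
  have htν {z : E2} (hz : z ∈ c.target) :
      ψ z 2 • fderiv ℝ ν z e₁ = (ν z 2 - k z) • fderiv ℝ ψ z e₁ := by
    rw [← hA hz, ← hB hz]
    exact hκ _ _ (hdt hz)
  have hmem := c.open_target.mem_nhds hx
  have hψs : ContDiffAt ℝ ∞ ψ x := (contDiffOn_comp_chart_symm hat hS.smooth).contDiffAt hmem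
  have hνs : ContDiffAt ℝ ∞ ν x :=
    (contDiffOn_comp_chart_symm hat hS.contMDiff_euclidNormal).contDiffAt hmem
  have hks : ContDiffAt ℝ ∞ k x :=
    (contDiffOn_comp_chart_symm hat (hN.contMDiff_secondCurvature hV hκ)).contDiffAt hmem
  have hle : minSmoothness ℝ 2 ≤ ∞ := by
    rw [minSmoothness_of_isRCLikeNormedField]; exact WithTop.coe_le_coe.2 (le_top (a := 2))
  have hψsym : IsSymmSndFDerivAt ℝ ψ x := hψs.isSymmSndFDerivAt hle
  have hνsym : IsSymmSndFDerivAt ℝ ν x := hνs.isSymmSndFDerivAt hle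
  have hx0 (v : E2) : x + (0 : ℝ) • v = x := by simp
  have d1 {F : Type} [NormedAddCommGroup F] [NormedSpace ℝ F] {W : E2 → F}
      (hW : ContDiffAt ℝ ∞ W x) (v : E2) :
      HasDerivAt (fun t : ℝ => W (x + t • v)) (fderiv ℝ W x v) 0 :=
    (hW.differentiableAt (by simp)).hasFDerivAt.comp_hasDerivAt_of_eq 0 (hasDerivAt_line x v)
      (hx0 v).symm
  have d2 {W : E2 → E3} (hW : ContDiffAt ℝ ∞ W x) (v u : E2) :
      HasDerivAt (fun t : ℝ => fderiv ℝ W (x + t • v) u) (fderiv ℝ (fderiv ℝ W) x v u) 0 := by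
    have h2 : HasFDerivAt (fderiv ℝ W) (fderiv ℝ (fderiv ℝ W) x) x :=
      ((hW.fderiv_right (m := 1) (by norm_cast)).differentiableAt (by simp)).hasFDerivAt
    have h3 : HasDerivAt (fun t : ℝ => fderiv ℝ W (x + t • v)) (fderiv ℝ (fderiv ℝ W) x v) 0 :=
      h2.comp_hasDerivAt_of_eq 0 (hasDerivAt_line x v) (hx0 v).symm
    simpa using h3.clm_apply (hasDerivAt_const (0 : ℝ) u)
  have hev (v : E2) : ∀ᶠ t : ℝ in nhds 0, x + t • v ∈ c.target :=
    (hasDerivAt_line x v).continuousAt.preimage_mem_nhds (by rwa [hx0])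
  have hn1 : HasDerivAt (fun t : ℝ => n (x + t • e₁))
      (fderiv ℝ (euclidUnit V) (ψ x) (fderiv ℝ ψ x e₁)) 0 :=
    (hV.hasFDerivAt_euclidUnit (hS.mem_hyp _)).comp_hasDerivAt_of_eq 0 (d1 hψs e₁) (by simp)
  -- D0 and D1 are the t-derivatives of the relations for ∂ₛψ and ∂ₛν; D2 is the s-derivative of the
  -- relation for ∂ₜν. D2 - D1 eliminates the mixed derivative of ν, and D0 supplies that of ψ.
  have D0 := (d2 hψs e₁ e₀).unique ((((hasDerivAt_height (d1 hψs e₁)).fun_smul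
    (hn1.fun_sub ((d1 hνs e₁).fun_const_smul (Real.cos θ)))).const_smul
      (Real.sin θ)⁻¹).congr_of_eventuallyEq ((hev e₁).mono fun t ht => hsψ ht))
  have D1 := ((hasDerivAt_height (d1 hψs e₁)).fun_smul (d2 hνs e₁ e₀)).unique
    ((((hasDerivAt_height (d1 hνs e₁)).add_const (Real.cos θ * f vert)).fun_smul
      (d2 hψs e₁ e₀)).congr_of_eventuallyEq ((hev e₁).mono fun t ht => hsν ht))
  have D2 := ((hasDerivAt_height (d1 hψs e₀)).fun_smul (d2 hνs e₀ e₁)).unique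
    ((((hasDerivAt_height (d1 hνs e₀)).fun_sub (d1 hks e₀)).fun_smul
      (d2 hψs e₀ e₁)).congr_of_eventuallyEq ((hev e₀).mono fun t ht => htν ht))
  rw [hψsym.eq e₀ e₁, hνsym.eq e₀ e₁] at D2
  simp only [hx0] at D0 D1 D2
  have hL := d1 hks e₀
  refine HasDerivAt.congr_deriv hL ?_
  have hy : ψ x 2 ≠ 0 := hS.height_ne_zero _
  have hDn := hV.fderiv_euclidUnit (hS.mem_hyp (c.symm x)) (fderiv ℝ ψ x e₁)
  have hA1n : inner ℝ (fderiv ℝ ψ x e₁) (n x) = (0 : ℝ) := by rw [← hA hx]; exact hdt hx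
  have hA1ν : inner ℝ (fderiv ℝ ψ x e₁) (ν x) = (0 : ℝ) := by
    rw [← hA hx, real_inner_comm]; exact hS.inner_euclidNormal_diff _ _
  have hinj : fderiv ℝ ψ x e₁ ≠ 0 := by
    rw [← hA hx, ← map_zero (diff φ (c.symm x)), ← map_zero (chartDeriv c x)]
    intro h0
    have h1 : e₁ 1 = 0 := by rw [chartDeriv_injective hat hx (hS.immersion _ h0)]; simp
    simp [e₁] at h1
  have hE0 := hsψ hx
  have hE1 := hsν hx
  have hE2 := htν hx
  have hpos : (inner ℝ (fderiv ℝ ψ x e₁) (fderiv ℝ ψ x e₁) : ℝ) ≠ 0 := fun h0 =>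
    hinj (inner_self_eq_zero.1 h0)
  change ψ x 2 • _ = (f (ψ x) + n x 2) • _ - (inner ℝ _ (n x) : ℝ) • _ at hDn
  rw [hA1n, zero_smul, sub_zero, hV.scalar_eq (hS.mem_hyp _)] at hDn
  change _ = -(Real.sin θ)⁻¹ * (Real.cos θ * f vert + k x) * (Real.cos θ * k x + f vert)
  generalize fderiv ℝ ψ x e₀ = A₀ at *
  generalize fderiv ℝ ψ x e₁ = A₁ at *
  generalize fderiv ℝ ν x e₀ = B₀ at *
  generalize fderiv ℝ ν x e₁ = B₁ at *
  generalize fderiv ℝ (fderiv ℝ ψ) x e₁ e₀ = C at *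
  generalize fderiv ℝ (fderiv ℝ ν) x e₁ e₀ = M at *
  generalize fderiv ℝ (euclidUnit V) (ψ x) A₁ = D at *
  have i0 := congrArg (fun z : E3 => (inner ℝ A₁ z : ℝ)) D0
  have i1 := congrArg (fun z : E3 => (inner ℝ A₁ z : ℝ)) D1
  have i2 := congrArg (fun z : E3 => (inner ℝ A₁ z : ℝ)) D2
  have j0 := congrArg (fun z : E3 => (inner ℝ A₁ z : ℝ)) hE0
  have j1 := congrArg (fun z : E3 => (inner ℝ A₁ z : ℝ)) hE1
  have j2 := congrArg (fun z : E3 => (inner ℝ A₁ z : ℝ)) hE2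
  have j3 := congrArg (fun z : E3 => (inner ℝ A₁ z : ℝ)) hDn
  have l0 := congrArg (fun z : E3 => z 2) hE0
  have l1 := congrArg (fun z : E3 => z 2) hE1
  simp only [inner_add_right, inner_sub_right, real_inner_smul_right, hA1n, hA1ν, PiLp.sub_apply,
    PiLp.smul_apply, smul_eq_mul, mul_zero, sub_zero, add_zero] at i0 i1 i2 j0 j1 j2 j3 l0 l1
  rw [j0, mul_zero, mul_eq_zero, or_iff_right hy] at j1
  rw [j1, j0] at i1
  apply mul_right_cancel₀ (mul_ne_zero hy hpos)
  linear_combination (ψ x 2) * (i2 - i1) + inner ℝ A₁ A₁ * l1 - A₀ 2 * j2 +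
    (Real.cos θ * f vert + k x) * (inner ℝ A₁ A₁ * l0 - ψ x 2 * i0 -
      ψ x 2 * (Real.sin θ)⁻¹ * (j3 - Real.cos θ * j2))

end IsConstantAngleSurface

end SecondCurvature

/-! ### Linear functions of the hyperboloid model in the upper half-space -/

/-- The function `(a + ⟨b, x⟩ + c |x|²) / x₃`; for horizontal `b` its hyperbolic Hessian is the
function times the metric. -/
def hypLin (a : ℝ) (b : E3) (c : ℝ) (q : E3) : ℝ :=
  (a + inner ℝ b q + c * inner ℝ q q) / q 2

/-- The derivative of `hypLin a b c` at `q` in the direction `x₃ m`. -/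
def hypLinDir (a : ℝ) (b : E3) (c : ℝ) (q m : E3) : ℝ :=
  inner ℝ b m + 2 * c * inner ℝ q m - hypLin a b c q * m 2

section HypLin

variable {a c : ℝ} {b : E3}

theorem hypLinDir_smul (q m : E3) (r : ℝ) :
    hypLinDir a b c q (r • m) = r * hypLinDir a b c q m := by
  simp only [hypLinDir, real_inner_smul_right, PiLp.smul_apply, smul_eq_mul]; ring

theorem hypLinDir_sub (q m m' : E3) :
    hypLinDir a b c q (m - m') = hypLinDir a b c q m - hypLinDir a b c q m' := by
  simp only [hypLinDir, inner_sub_right, PiLp.sub_apply]; ring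

theorem hypLinDir_add (q m m' : E3) :
    hypLinDir a b c q (m + m') = hypLinDir a b c q m + hypLinDir a b c q m' := by
  simp only [hypLinDir, inner_add_right, PiLp.add_apply]; ring

theorem hypLinDir_vert (hb : b 2 = 0) (q : E3) :
    hypLinDir a b c q vert = 2 * c * q 2 - hypLin a b c q := by
  simp only [hypLinDir, inner_vert_right, vert_apply_two, hb]; ring

theorem contDiffAt_hypLin {q : E3} (hq : q ∈ hyp) : ContDiffAt ℝ ∞ (hypLin a b c) q := by
  have h1 : ContDiffAt ℝ ∞ (fun q : E3 => a + inner ℝ b q + c * inner ℝ q q) q :=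
    (contDiffAt_const.add (contDiffAt_const.inner ℝ contDiffAt_id)).add
      (contDiffAt_const.mul (contDiffAt_id.inner ℝ contDiffAt_id))
  exact h1.div contDiff_height.contDiffAt (ne_of_gt hq)

theorem contDiffAt_hypLinDir {q m : E3} (hq : q ∈ hyp) :
    ContDiffAt ℝ ∞ (fun z : E3 × E3 => hypLinDir a b c z.1 z.2) (q, m) := by
  have h1 : ContDiffAt ℝ ∞
      (fun z : E3 × E3 => inner ℝ b z.2 + 2 * c * inner ℝ z.1 z.2) (q, m) :=
    (contDiffAt_const.inner ℝ contDiffAt_snd).add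
      (contDiffAt_const.mul (contDiffAt_fst.inner ℝ contDiffAt_snd))
  have h2 : ContDiffAt ℝ ∞ (fun z : E3 × E3 => hypLin a b c z.1) (q, m) :=
    (contDiffAt_hypLin hq).comp (q, m) contDiffAt_fst
  have h3 : ContDiffAt ℝ ∞ (fun z : E3 × E3 => z.2 2) (q, m) :=
    contDiff_height.contDiffAt.comp (q, m) contDiffAt_snd
  exact h1.sub (h2.mul h3)

theorem hasDerivAt_hypLin {γ : ℝ → E3} {X : E3} {t : ℝ} (hγ : HasDerivAt γ X t)
    (ht : γ t ∈ hyp) :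
    HasDerivAt (fun s => hypLin a b c (γ s)) (hypLinDir a b c (γ t) X / γ t 2) t := by
  have hy : γ t 2 ≠ 0 := ne_of_gt ht
  have h1 := (((((hasDerivAt_const t b).inner ℝ hγ).const_add a).fun_add
    ((hγ.inner ℝ hγ).const_mul c))).fun_div (hasDerivAt_height hγ) hy
  refine h1.congr_deriv ?_
  simp only [hypLinDir, hypLin, inner_zero_left, real_inner_comm (γ t) X]
  field_simp
  ring

theorem hasDerivAt_hypLinDir {γ m : ℝ → E3} {X Y : E3} {t : ℝ} (hγ : HasDerivAt γ X t)
    (hm : HasDerivAt m Y t) (ht : γ t ∈ hyp) :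
    HasDerivAt (fun s => hypLinDir a b c (γ s) (m s)) (hypLinDir a b c (γ t) Y +
      2 * c * inner ℝ X (m t) - hypLinDir a b c (γ t) X / γ t 2 * m t 2) t := by
  have h1 := (((hasDerivAt_const t b).inner ℝ hm).fun_add
    ((hγ.inner ℝ hm).const_mul (2 * c))).fun_sub
      ((hasDerivAt_hypLin (a := a) (b := b) (c := c) hγ ht).fun_mul (hasDerivAt_height hm))
  refine h1.congr_deriv ?_
  rw [inner_zero_left]
  simp only [hypLinDir]
  ring

end HypLin

/-- A function whose logarithm is, up to a constant factor, a potential of the dual form of `V`. -/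
def potential (V : E3 → E3) (f : E3 → ℝ) (q : E3) : ℝ :=
  hypLinDir 1 0 1 q (euclidUnit V q) - f vert * hypLin 1 0 1 q

namespace IsUnitAntiTorqued

variable {V : E3 → E3} {f : E3 → ℝ} (hV : IsUnitAntiTorqued V f) {a c : ℝ} {b : E3}
include hV

/-- The product rule X⟨V,∇ℓ⟩ = ⟨∇_X V,∇ℓ⟩ + Hess ℓ(X,V) with Hess ℓ = ℓ⟨·,·⟩. A vertical component
of b would add a constant to ℓ and spoil the Hessian identity. -/
theorem hasDerivAt_hypLinDir_euclidUnit (hb : b 2 = 0) {γ : ℝ → E3} {X : E3} {t : ℝ}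
    (hγ : HasDerivAt γ X t) (ht : γ t ∈ hyp) :
    HasDerivAt (fun s => hypLinDir a b c (γ s) (euclidUnit V (γ s)))
      ((f vert * hypLinDir a b c (γ t) X - inner ℝ X (euclidUnit V (γ t)) *
        (f vert * hypLinDir a b c (γ t) (euclidUnit V (γ t)) - hypLin a b c (γ t))) / γ t 2) t := by
  have hy : γ t 2 ≠ 0 := ne_of_gt ht
  have h1 := (hV.hasFDerivAt_euclidUnit ht).comp_hasDerivAt t hγ
  refine (hasDerivAt_hypLinDir hγ h1 ht).congr_deriv ?_
  have h2 := congrArg (hypLinDir a b c (γ t)) (hV.fderiv_euclidUnit ht X)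
  simp only [hypLinDir_smul, hypLinDir_sub, hypLinDir_add, hypLinDir_vert hb] at h2
  rw [hV.scalar_eq ht] at h2
  field_simp
  simp only [Function.comp]
  linear_combination h2

theorem contDiffAt_potential {q : E3} (hq : q ∈ hyp) : ContDiffAt ℝ ∞ (potential V f) q := by
  have h1 : ContDiffAt ℝ ∞ (fun z => hypLinDir 1 0 1 z (euclidUnit V z)) q :=
    ContDiffAt.comp (f := fun z => (z, euclidUnit V z)) q (contDiffAt_hypLinDir hq)
      (contDiffAt_id.prodMk (hV.contDiffAt_euclidUnit hq))
  exact h1.sub (contDiffAt_const.mul (contDiffAt_hypLin hq))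

theorem hasDerivAt_potential {γ : ℝ → E3} {X : E3} {t : ℝ}
    (hγ : HasDerivAt γ X t) (ht : γ t ∈ hyp) : HasDerivAt (fun s => potential V f (γ s))
      (-f vert * inner ℝ X (euclidUnit V (γ t)) / γ t 2 * potential V f (γ t)) t := by
  have h1 := (hV.hasDerivAt_hypLinDir_euclidUnit (a := 1) (b := 0) (c := 1) (by simp) hγ ht).fun_sub
    ((hasDerivAt_hypLin (a := 1) (b := 0) (c := 1) hγ ht).const_mul (f vert))
  refine h1.congr_deriv ?_
  have hf := hV.scalar_sq_eq_one vert_mem_hyp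
  rw [potential]
  linear_combination (-inner ℝ X (euclidUnit V (γ t)) / γ t 2 * hypLin 1 0 1 (γ t)) * hf

/-- A nonzero null vector is never orthogonal to a timelike one. In coordinates, a zero of the
potential makes a sum of three squares vanish, which forces n = -f∂₃, and there the potential is
visibly nonzero. -/
theorem potential_ne_zero {q : E3} (hq : q ∈ hyp) : potential V f q ≠ 0 := by
  have hy : q 2 ≠ 0 := ne_of_gt hq
  have hf := hV.scalar_sq_eq_one vert_mem_hyp
  have hn := hV.inner_euclidUnit hq
  intro h0
  rw [potential] at h0
  set n := euclidUnit V q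
  simp only [hypLinDir, hypLin, inner_zero_left, PiLp.inner_apply, Fin.sum_univ_three,
    RCLike.inner_apply, conj_trivial] at h0 hn
  field_simp at h0
  set F := f vert
  have hF : F ≠ 0 := fun h => by simp [h] at hf
  have h1 : (1 + F * n 2) ^ 2 + ((1 + F * n 2) * q 0 - q 2 * F * n 0) ^ 2 +
      ((1 + F * n 2) * q 1 - q 2 * F * n 1) ^ 2 = 0 := by
    linear_combination -(1 + F * n 2) * F * h0 + (q 2 ^ 2 * (n 0 ^ 2 + n 1 ^ 2 + n 2 ^ 2) -
      (1 + F * n 2) * (1 + q 0 ^ 2 + q 1 ^ 2 + q 2 ^ 2)) * hf + q 2 ^ 2 * hn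
  have s0 := sq_nonneg (1 + F * n 2)
  have s1 := sq_nonneg ((1 + F * n 2) * q 0 - q 2 * F * n 0)
  have s2 := sq_nonneg ((1 + F * n 2) * q 1 - q 2 * F * n 1)
  have t0 : 1 + F * n 2 = 0 := (pow_eq_zero_iff two_ne_zero).1 (by linarith)
  have t1 : (1 + F * n 2) * q 0 - q 2 * F * n 0 = 0 :=
    (pow_eq_zero_iff two_ne_zero).1 (by linarith)
  have t2 : (1 + F * n 2) * q 1 - q 2 * F * n 1 = 0 :=
    (pow_eq_zero_iff two_ne_zero).1 (by linarith)
  have n0 : n 0 = 0 := by simpa [t0, hy, hF] using t1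
  have n1 : n 1 = 0 := by simpa [t0, hy, hF] using t2
  have : 2 * q 2 ^ 2 = 0 := by
    rw [n0, n1] at h0
    linear_combination -F * h0 - (1 + q 0 ^ 2 + q 1 ^ 2 + q 2 ^ 2) * hf +
      (2 * q 2 ^ 2 - (1 + q 0 ^ 2 + q 1 ^ 2 + q 2 ^ 2)) * t0
  simp [hy] at this

end IsUnitAntiTorqued

/-! ### Adapted coordinates -/

section AdaptedCoordinates

/-- The inverse function theorem, with a smooth inverse on an open set. -/
theorem exists_smooth_localInverse {F : E2 → E2} {s : Set E2} (hs : IsOpen s)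
    (hF : ContDiffOn ℝ ∞ F s) {x : E2} (hx : x ∈ s)
    (hinj : Function.Injective (fderiv ℝ F x)) :
    ∃ e : OpenPartialHomeomorph E2 E2, x ∈ e.source ∧ e.source ⊆ s ∧ (e : E2 → E2) = F ∧
      ContDiffOn ℝ ∞ e.symm e.target := by
  have hFx {z : E2} (hz : z ∈ s) : ContDiffAt ℝ ∞ F z := hF.contDiffAt (hs.mem_nhds hz)
  have hFd {z : E2} (hz : z ∈ s) : HasFDerivAt F (fderiv ℝ F z) z :=
    ((hFx hz).differentiableAt (by simp)).hasFDerivAt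
  set L : E2 ≃L[ℝ] E2 :=
    -- An injective endomorphism of the plane is invertible.
    (LinearEquiv.ofInjectiveEndo (fderiv ℝ F x).toLinearMap hinj).toContinuousLinearEquiv with hL
  have hLx : (L : E2 →L[ℝ] E2) = fderiv ℝ F x := by ext v; rfl
  have hxd : HasFDerivAt F (L : E2 →L[ℝ] E2) x := by rw [hLx]; exact hFd hx
  set e₀ := (hFx hx).toOpenPartialHomeomorph F hxd (by simp) with he₀
  -- The local inverse is restricted to the open set where dF is invertible, which makes it smooth
  -- at every point of the target.
  have hopen : IsOpen (s ∩ fderiv ℝ F ⁻¹' Set.range ((↑) : (E2 ≃L[ℝ] E2) → E2 →L[ℝ] E2)) :=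
    (hF.continuousOn_fderiv_of_isOpen hs (by simp)).isOpen_inter_preimage hs
      (ContinuousLinearEquiv.isOpen)
  refine ⟨e₀.restrOpen _ hopen, ⟨?_, hx, L, hLx⟩, fun z hz => hz.2.1, rfl, fun y hy => ?_⟩
  · exact (hFx hx).mem_toOpenPartialHomeomorph_source hxd (by simp)
  · have hz := (e₀.restrOpen _ hopen).map_target hy
    obtain ⟨M, hM⟩ := hz.2.2
    refine ((e₀.restrOpen _ hopen).contDiffAt_symm hy (f₀' := M) ?_ ?_).contDiffWithinAt
    · rw [hM]; exact hFd hz.2.1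
    · exact hFx hz.2.1

variable {N : Type*} [TopologicalSpace N] [ChartedSpace E2 N] [IsManifold (𝓡 2) ∞ N]

/-- Two functions with independent differentials at a point are coordinates around it. -/
theorem exists_chart_of_functions {S R : N → ℝ} (hS : ContMDiff (𝓡 2) 𝓘(ℝ, ℝ) ∞ S)
    (hR : ContMDiff (𝓡 2) 𝓘(ℝ, ℝ) ∞ R) (p : N)
    (h : ∀ X : TangentSpace (𝓡 2) p, scalarDiff S p X = 0 → scalarDiff R p X = 0 → X = 0) :
    ∃ c ∈ IsManifold.maximalAtlas (𝓡 2) ∞ N, p ∈ c.source ∧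
      ∀ y ∈ c.target, S (c.symm y) = y 0 ∧ R (c.symm y) = y 1 := by
  obtain ⟨c, hc, x, hx, rfl⟩ := exists_chart p
  set F : E2 → E2 := fun z => !₂[S (c.symm z), R (c.symm z)] with hFdef
  have hSc := contDiffOn_comp_chart_symm hc hS
  have hRc := contDiffOn_comp_chart_symm hc hR
  have hF : ContDiffOn ℝ ∞ F c.target := by
    rw [contDiffOn_euclidean]
    intro i
    fin_cases i
    · exact hSc
    · exact hRc
  have hFd : HasFDerivAt F (fderiv ℝ F x) x :=
    ((hF.contDiffAt (c.open_target.mem_nhds hx)).differentiableAt (by simp)).hasFDerivAt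
  have hcoord (i : Fin 2) := (EuclideanSpace.proj i : E2 →L[ℝ] ℝ).hasFDerivAt.comp x hFd
  have hS' := (hcoord 0).unique
    (hasFDerivAt_scalarDiff_comp hc hx ((hS _).mdifferentiableAt (by simp)))
  have hR' := (hcoord 1).unique
    (hasFDerivAt_scalarDiff_comp hc hx ((hR _).mdifferentiableAt (by simp)))
  have hinj : Function.Injective (fderiv ℝ F x) := by
    refine (injective_iff_map_eq_zero _).2 fun v hv => ?_
    have e1 := congrArg (fun L : E2 →L[ℝ] ℝ => L v) hS'
    have e2 := congrArg (fun L : E2 →L[ℝ] ℝ => L v) hR'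
    simp only [ContinuousLinearMap.comp_apply, hv, map_zero] at e1 e2
    have := h _ e1.symm e2.symm
    exact chartDeriv_injective hc hx (this.trans (map_zero _).symm)
  obtain ⟨e, hxe, hes, heF, hesymm⟩ := exists_smooth_localInverse c.open_target hF hx hinj
  refine ⟨c.trans e, ?_, ?_, fun y hy => ?_⟩
  · refine OpenPartialHomeomorph.mem_maximalAtlas_of_contMDiffOn _ ?_ ?_
    · have h1 : ContMDiffOn (𝓡 2) (𝓡 2) ∞ e e.source := by
        rw [heF]; exact (hF.mono hes).contMDiffOn
      refine h1.comp ((contMDiffOn_of_mem_maximalAtlas hc).mono ?_) ?_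
      · intro q hq; rw [OpenPartialHomeomorph.trans_source] at hq; exact hq.1
      · intro q hq; rw [OpenPartialHomeomorph.trans_source] at hq; exact hq.2
    · have h1 : ContMDiffOn (𝓡 2) (𝓡 2) ∞ e.symm e.target := hesymm.contMDiffOn
      refine (contMDiffOn_symm_of_mem_maximalAtlas hc).comp (h1.mono ?_) ?_
      · intro q hq; rw [OpenPartialHomeomorph.trans_target] at hq; exact hq.1
      · intro q hq; rw [OpenPartialHomeomorph.trans_target] at hq; exact hq.2
  · rw [OpenPartialHomeomorph.trans_source]
    exact ⟨c.map_target hx, by rwa [Set.mem_preimage, c.right_inv hx]⟩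
  · rw [OpenPartialHomeomorph.trans_target] at hy
    have h1 : F (e.symm y) = y := by rw [← heF]; exact e.right_inv hy.1
    exact ⟨congrArg (fun z : E2 => z 0) h1, congrArg (fun z : E2 => z 1) h1⟩

namespace IsConstantAngleSurface

variable {φ U : N → E3} {V : E3 → E3} {θ : ℝ} {f : E3 → ℝ}
  (hN : IsConstantAngleSurface φ U V θ) (hV : IsUnitAntiTorqued V f)

/-- The arc length parameter of the integral curves of `T`. -/
def arcCoord (φ : N → E3) (V : E3 → E3) (f : E3 → ℝ) (θ : ℝ) (p : N) : ℝ :=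
  -(f vert / Real.sin θ) * Real.log (potential V f (φ p))

/-- Combinations of first integrals of the field `T`. -/
def transverseCoord (φ U : N → E3) (V : E3 → E3) (f : E3 → ℝ) (θ a : ℝ) (b : E3) (α β : ℝ)
    (p : N) : ℝ :=
  α * (hypLinDir a b 0 (φ p) (euclidNormal φ U p) - f vert * Real.cos θ * hypLin a b 0 (φ p)) +
    β * potential V f (φ p) * (hypLinDir a b 0 (φ p) (euclidUnit V (φ p)) +
      f vert * hypLin a b 0 (φ p) -
      2 * Real.cos θ * hypLinDir a b 0 (φ p) (euclidNormal φ U p))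

include hN hV

omit [IsManifold (𝓡 2) ∞ N] in
theorem contMDiff_arcCoord : ContMDiff (𝓡 2) 𝓘(ℝ, ℝ) ∞ (arcCoord φ V f θ) := fun p => by
  have hp := hN.surface.mem_hyp p
  have h1 : ContDiffAt ℝ ∞ (fun q => -(f vert / Real.sin θ) * Real.log (potential V f q)) (φ p) :=
    contDiffAt_const.mul ((hV.contDiffAt_potential hp).log (hV.potential_ne_zero hp))
  exact h1.comp_contMDiffAt (hN.surface.smooth p)

theorem scalarDiff_arcCoord (p : N) (X : TangentSpace (𝓡 2) p) :
    scalarDiff (arcCoord φ V f θ) p X =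
      inducedInner φ p (unitTangentPart φ U V p) X := by
  have hp := hN.surface.mem_hyp p
  have hf := hV.scalar_sq_eq_one vert_mem_hyp
  have hG := hV.potential_ne_zero hp
  obtain ⟨σ, hσ, hd, hd'⟩ := exists_curve p X
  have h1 := hd' ((hN.contMDiff_arcCoord hV p).mdifferentiableAt (by simp))
  have h2 := hV.hasDerivAt_potential (hd (hN.surface.mdifferentiableAt p)) (by rwa [hσ])
  -- Only G ≠ 0 is required: `Real.log` is log|·|, so the sign of G plays no role.
  have h3 := h1.unique ((h2.log (by rwa [hσ])).const_mul (-(f vert / Real.sin θ)))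
  rw [h3, hN.inducedInner_unitTangentPart hV, hσ, mul_div_cancel_right₀ _ hG]
  linear_combination (Real.sin θ)⁻¹ * inner ℝ (diff φ p X) (euclidUnit V (φ p)) / φ p 2 * hf

variable {a α β : ℝ} {b : E3}

omit [IsManifold (𝓡 2) ∞ N] in
theorem contMDiff_transverseCoord :
    ContMDiff (𝓡 2) 𝓘(ℝ, ℝ) ∞ (transverseCoord φ U V f θ a b α β) := fun p => by
  have hp := hN.surface.mem_hyp p
  have c1 : ContMDiffAt (𝓡 2) 𝓘(ℝ, ℝ) ∞
      (fun p => hypLinDir a b 0 (φ p) (euclidNormal φ U p)) p :=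
    ContDiffAt.comp_contMDiffAt (g := fun z : E3 × E3 => hypLinDir a b 0 z.1 z.2)
      (f := fun p => (φ p, euclidNormal φ U p)) (contDiffAt_hypLinDir hp)
      ((hN.surface.smooth p).prodMk_space (hN.surface.contMDiff_euclidNormal p))
  have c2 : ContMDiffAt (𝓡 2) 𝓘(ℝ, ℝ) ∞
      (fun p => hypLinDir a b 0 (φ p) (euclidUnit V (φ p))) p :=
    ContDiffAt.comp_contMDiffAt (g := fun z : E3 × E3 => hypLinDir a b 0 z.1 z.2)
      (f := fun p => (φ p, euclidUnit V (φ p))) (contDiffAt_hypLinDir hp)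
      ((hN.surface.smooth p).prodMk_space (hN.contMDiff_euclidUnit hV p))
  have c3 : ContMDiffAt (𝓡 2) 𝓘(ℝ, ℝ) ∞ (fun p => hypLin a b 0 (φ p)) p :=
    (contDiffAt_hypLin hp).comp_contMDiffAt (hN.surface.smooth p)
  have c4 : ContMDiffAt (𝓡 2) 𝓘(ℝ, ℝ) ∞ (fun p => potential V f (φ p)) p :=
    (hV.contDiffAt_potential hp).comp_contMDiffAt (hN.surface.smooth p)
  exact (contMDiffAt_const.mul (c1.sub (contMDiffAt_const.mul c3))).add
    ((contMDiffAt_const.mul c4).mul ((c2.add (contMDiffAt_const.mul c3)).sub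
      (contMDiffAt_const.mul c1)))

/-- Stated for any principal X with curvature k, so that it serves both for T, where the result is
zero, and for the orthogonal direction, where the last term drops out. -/
theorem scalarDiff_transverseCoord (hb : b 2 = 0) (p : N) {X : TangentSpace (𝓡 2) p} {k : ℝ}
    (hX : φ p 2 • diff (euclidNormal φ U) p X = (euclidNormal φ U p 2 - k) • diff φ p X) :
    φ p 2 * scalarDiff (transverseCoord φ U V f θ a b α β) p X =
      (2 * β * potential V f (φ p) * (f vert + Real.cos θ * k) -
        α * (k + Real.cos θ * f vert)) * hypLinDir a b 0 (φ p) (diff φ p X) -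
      2 * β * potential V f (φ p) * f vert * inner ℝ (diff φ p X) (euclidUnit V (φ p)) *
        (hypLinDir a b 0 (φ p) (euclidUnit V (φ p)) -
          Real.cos θ * hypLinDir a b 0 (φ p) (euclidNormal φ U p)) := by
  have hp := hN.surface.mem_hyp p
  have hy := hN.surface.height_ne_zero p
  have hf := hV.scalar_sq_eq_one vert_mem_hyp
  obtain ⟨σ, hσ, hd, hd'⟩ := exists_curve p X
  have hσp : φ (σ 0) ∈ hyp := by rwa [hσ]
  have h0 := hd' ((hN.contMDiff_transverseCoord hV (a := a) (b := b) (α := α) (β := β)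
    p).mdifferentiableAt (by simp))
  have hφ := hd (hN.surface.mdifferentiableAt p)
  have h1 := hasDerivAt_hypLinDir (a := a) (b := b) (c := 0) hφ
    (hd (hN.surface.mdifferentiableAt_euclidNormal p)) hσp
  have h2 := hV.hasDerivAt_hypLinDir_euclidUnit (a := a) (b := b) (c := 0) hb hφ hσp
  have h3 := hasDerivAt_hypLin (a := a) (b := b) (c := 0) hφ hσp
  have h4 := hV.hasDerivAt_potential hφ hσp
  have h5 := h0.unique (((h1.fun_sub (h3.const_mul (f vert * Real.cos θ))).const_mul α).fun_add
    ((h4.const_mul β).fun_mul ((h2.fun_add (h3.const_mul (f vert))).fun_sub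
      (h1.const_mul (2 * Real.cos θ)))))
  rw [hσ] at h5
  have h6 := congrArg (hypLinDir a b 0 (φ p)) hX
  rw [hypLinDir_smul, hypLinDir_smul] at h6
  have h7 : hypLinDir a b 0 (φ p) (diff (euclidNormal φ U) p X) =
      (euclidNormal φ U p 2 - k) * hypLinDir a b 0 (φ p) (diff φ p X) / φ p 2 := by
    rw [← h6]; field_simp
  rw [h5, h7]
  field_simp
  linear_combination -(β * potential V f (φ p) * inner ℝ (diff φ p X) (euclidUnit V (φ p)) *
    hypLin a b 0 (φ p)) * hf

end IsConstantAngleSurface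

end AdaptedCoordinates

/-! ### Existence of adapted charts -/

section AdaptedChart

variable {N : Type*} [TopologicalSpace N] [ChartedSpace E2 N]

/-- In coordinates given by functions `S`, `R`, the coordinates of a tangent vector are its
derivatives of `S` and `R`. -/
theorem scalarDiff_chartDeriv {c : OpenPartialHomeomorph N E2}
    (hc : c ∈ IsManifold.maximalAtlas (𝓡 2) ∞ N) {S : N → ℝ}
    (hS : ContMDiff (𝓡 2) 𝓘(ℝ, ℝ) ∞ S) {i : Fin 2} (hSi : ∀ y ∈ c.target, S (c.symm y) = y i)
    {y : E2} (hy : y ∈ c.target) (u : E2) :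
    scalarDiff S (c.symm y) (chartDeriv c y u) = u i := by
  have h1 := hasFDerivAt_scalarDiff_comp hc hy ((hS _).mdifferentiableAt (by simp))
  have h2 := (EuclideanSpace.proj i : E2 →L[ℝ] ℝ).hasFDerivAt (x := y)
  have h3 := h1.unique (h2.congr_of_eventuallyEq
    (by filter_upwards [c.open_target.mem_nhds hy] with z hz using hSi z hz))
  exact congrArg (fun L : E2 →L[ℝ] ℝ => L u) h3

variable [IsManifold (𝓡 2) ∞ N]

namespace IsConstantAngleSurface

variable {φ U : N → E3} {V : E3 → E3} {θ : ℝ} {f : E3 → ℝ}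
  (hN : IsConstantAngleSurface φ U V θ) (hV : IsUnitAntiTorqued V f)
include hN hV

theorem scalarDiff_transverseCoord_unitTangentPart {a α β : ℝ} {b : E3} (hb : b 2 = 0) (p : N) :
    scalarDiff (transverseCoord φ U V f θ a b α β) p (unitTangentPart φ U V p) = 0 := by
  have : Nonempty N := ⟨p⟩
  have hs := (hN.sin_pos hV).ne'
  have hy := hN.surface.height_ne_zero p
  have h1 := hN.scalarDiff_transverseCoord hV (a := a) (α := α) (β := β) hb p
    (X := unitTangentPart φ U V p) (k := -(Real.cos θ * f vert)) (by
      rw [hN.smul_diff_euclidNormal_unitTangentPart hV, sub_neg_eq_add])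
  have h2 := hN.inner_tangentDir_diff p (unitTangentPart φ U V p)
  rw [hN.diff_unitTangentPart hV, real_inner_smul_right, hN.inner_tangentDir hV] at h2
  have h3 : inner ℝ (φ p 2 • tangentDir φ U V θ p) (euclidUnit V (φ p)) =
      φ p 2 * Real.sin θ := by
    field_simp at h2
    linarith
  rw [hN.diff_unitTangentPart hV, h3, tangentDir, hypLinDir_smul, hypLinDir_smul, hypLinDir_sub,
    hypLinDir_smul] at h1
  have h4 : φ p 2 * scalarDiff (transverseCoord φ U V f θ a b α β) p (unitTangentPart φ U V p)
      = 0 := by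
    rw [h1]
    -- For k = -f cos θ the α-term vanishes and f + k cos θ = f sin²θ, which cancels the last term
    -- because sin θ times `tangentDir` is n - cos θ ν.
    have hsc := Real.sin_sq_add_cos_sq θ
    field_simp
    rw [← hsc]
    ring
  exact (mul_eq_zero.1 h4).resolve_left hy

omit [IsManifold (𝓡 2) ∞ N] in
-- T has coordinates dS(T) = |T|² = 1 and dR(T) = 0, so it equals ∂ₛ; then ⟨∂ₛ,∂ₜ⟩ = dS(∂ₜ) = 0, and
-- λ is the length of ∂ₜ.
theorem isAdaptedChart_of_functions {S R : N → ℝ} (hS : ContMDiff (𝓡 2) 𝓘(ℝ, ℝ) ∞ S)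
    (hR : ContMDiff (𝓡 2) 𝓘(ℝ, ℝ) ∞ R)
    (hSd : ∀ (p : N) (X : TangentSpace (𝓡 2) p),
      scalarDiff S p X = inducedInner φ p (unitTangentPart φ U V p) X)
    (hRd : ∀ p : N, scalarDiff R p (unitTangentPart φ U V p) = 0)
    {c : OpenPartialHomeomorph N E2} (hc : c ∈ IsManifold.maximalAtlas (𝓡 2) ∞ N)
    (h : ∀ y ∈ c.target, S (c.symm y) = y 0 ∧ R (c.symm y) = y 1) :
    IsAdaptedChart φ U V c := by
  have hSh := hN.surface
  have dS {y : E2} (hy : y ∈ c.target) (u : E2) :=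
    scalarDiff_chartDeriv hc hS (fun y hy => (h y hy).1) hy u
  have dR {y : E2} (hy : y ∈ c.target) (u : E2) :=
    scalarDiff_chartDeriv hc hR (fun y hy => (h y hy).2) hy u
  have hds : ∀ y ∈ c.target, coordField c 0 y = unitTangentPart φ U V (c.symm y) := by
    intro y hy
    obtain ⟨u, hu⟩ := chartDeriv_surjective hc hy (unitTangentPart φ U V (c.symm y))
    have h0 : u 0 = 1 := by
      rw [← dS hy, hu, hSd, hN.inducedInner_unitTangentPart_self hV]
    have h1 : u 1 = 0 := by rw [← dR hy, hu, hRd]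
    have h2 : u = EuclideanSpace.single 0 (1 : ℝ) := by
      rw [eq_add_smul_single u, h0, h1]; simp
    rw [← hu, h2]; rfl
  refine ⟨hc, hds, fun y => Real.sqrt (inducedInner φ (c.symm y) (coordField c 1 y)
    (coordField c 1 y)), ?_, fun y hy => ?_⟩
  all_goals
    have hpos : ∀ y ∈ c.target,
        0 < inducedInner φ (c.symm y) (coordField c 1 y) (coordField c 1 y) := by
      intro y hy
      have hne : diff φ (c.symm y) (coordField c 1 y) ≠ 0 := fun h0 => by
        have h1 : coordField c 1 y = 0 := hSh.immersion _ (h0.trans (map_zero _).symm)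
        have h2 := chartDeriv_injective hc hy (h1.trans (map_zero _).symm)
        simp at h2
      exact div_pos (real_inner_self_pos.2 hne) (pow_pos (hSh.height_pos _) 2)
  · have hψ := contDiffOn_comp_chart_symm hc hSh.smooth
    have hy : ContDiffOn ℝ ∞ (fun x => φ (c.symm x) 2) c.target :=
      contDiff_height.comp_contDiffOn hψ
    have hF : ContDiffOn ℝ ∞ (fun x => diff φ (c.symm x) (coordField c 1 x)) c.target :=
      ((hψ.fderiv_of_isOpen c.open_target le_rfl).clm_apply contDiffOn_const).congr fun x hx => by
        rw [(hasFDerivAt_diff_comp hc hx (hSh.mdifferentiableAt _)).fderiv]; rfl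
    exact ((hF.inner ℝ hF).div (hy.pow 2) fun x _ => pow_ne_zero 2 (hSh.height_ne_zero _)).sqrt
      fun x hx => (hpos x hx).ne'
  · refine ⟨Real.sqrt_pos.2 (hpos y hy), ?_, ?_, (Real.sq_sqrt (hpos y hy).le).symm⟩
    · rw [hds y hy, hN.inducedInner_unitTangentPart_self hV]
    · rw [hds y hy, ← hSd]
      exact (dS hy _).trans (by simp)

theorem exists_isAdaptedChart (p : N) :
    ∃ c : OpenPartialHomeomorph N E2, p ∈ c.source ∧ IsAdaptedChart φ U V c := by
  have : Nonempty N := ⟨p⟩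
  have hs := (hN.sin_pos hV).ne'
  have hSh := hN.surface
  have hp := hSh.mem_hyp p
  have hy := hSh.height_ne_zero p
  have hf := hV.scalar_sq_eq_one vert_mem_hyp
  have hG := hV.potential_ne_zero hp
  obtain ⟨k, hk⟩ := hN.exists_secondCurvature hV p
  obtain ⟨w, e, hww, hwν, hwn, he, hz⟩ := hN.exists_frame hV p
  -- Here b is the horizontal part of w, and a makes the numerator of ℓ equal to -w₃ at φ(p). The
  -- derivative of ℓ along x₃w is then 1 - w₃² + w₃²/x₃ > 0.
  set b : E3 := w - w 2 • vert with hbdef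
  have hb : b 2 = 0 := by simp [hbdef, vert_apply_two]
  set a : ℝ := -inner ℝ b (φ p) - w 2 with ha
  -- The weights turn the transverse derivative into a positive combination of (k + f cos θ)² and
  -- G²(f + k cos θ)². If both vanished, f² = 1 would give sin θ = 0.
  set α : ℝ := -(k + Real.cos θ * f vert) with hα
  set β : ℝ := potential V f (φ p) * (f vert + Real.cos θ * k) with hβ
  have hω : 0 < hypLinDir a b 0 (φ p) w := by
    have h1 : hypLinDir a b 0 (φ p) w = 1 - w 2 ^ 2 + w 2 ^ 2 / φ p 2 := by
      rw [hypLinDir, hypLin, ha, hbdef, inner_sub_left, real_inner_smul_left, inner_vert_left, hww]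
      field_simp
      ring
    have h2 : w 2 ^ 2 ≤ 1 := (sq_le_one_iff_abs_le_one _).2 (abs_apply_two_le hww)
    rw [h1]
    rcases eq_or_ne (w 2) 0 with h0 | h0
    · simp [h0]
    · have := div_pos (pow_pos (abs_pos.2 h0) 2) (hSh.height_pos p)
      rw [sq_abs] at this
      linarith
  have hcoef : 2 * β * potential V f (φ p) * (f vert + Real.cos θ * k) -
      α * (k + Real.cos θ * f vert) ≠ 0 := by
    intro h0
    have h1 : 2 * (potential V f (φ p) * (f vert + Real.cos θ * k)) ^ 2 +
        (k + Real.cos θ * f vert) ^ 2 = 0 := by rw [← h0, hα, hβ]; ring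
    have s1 := sq_nonneg (potential V f (φ p) * (f vert + Real.cos θ * k))
    have s2 := sq_nonneg (k + Real.cos θ * f vert)
    have h2 := (pow_eq_zero_iff two_ne_zero).1
      (show (potential V f (φ p) * (f vert + Real.cos θ * k)) ^ 2 = 0 by linarith)
    have h3 := (pow_eq_zero_iff two_ne_zero).1
      (show (k + Real.cos θ * f vert) ^ 2 = 0 by linarith)
    rw [mul_eq_zero, or_iff_right hG] at h2
    have h4 : Real.sin θ ^ 2 = 0 := by
      linear_combination Real.sin_sq θ + f vert * h2 - Real.cos θ * f vert * h3 +
        (Real.cos θ ^ 2 - 1) * hf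
    exact hs ((pow_eq_zero_iff two_ne_zero).1 h4)
  obtain ⟨c, hc, hpc, hcoord⟩ := exists_chart_of_functions (hN.contMDiff_arcCoord hV)
    (hN.contMDiff_transverseCoord hV (a := a) (b := b) (α := α) (β := β)) p fun X hX0 hX1 => by
      rw [hN.scalarDiff_arcCoord hV, hN.inducedInner_unitTangentPart hV] at hX0
      have hXn : inner ℝ (diff φ p X) (euclidUnit V (φ p)) = (0 : ℝ) := by simpa [hs, hy] using hX0
      have h1 := hN.scalarDiff_transverseCoord hV (a := a) (α := α) (β := β) hb p (hk X hXn)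
      rw [hX1, mul_zero, hXn, mul_zero, zero_mul, sub_zero, zero_eq_mul, or_iff_right hcoef] at h1
      have h2 := hz _ (hSh.inner_euclidNormal_diff p X)
      rw [hN.inner_tangentDir_diff, hXn, mul_zero, zero_smul, zero_add] at h2
      rw [h2, hypLinDir_smul, mul_eq_zero, or_iff_left hω.ne'] at h1
      rw [h1, zero_smul] at h2
      exact hSh.immersion p (h2.trans (map_zero _).symm)
  exact ⟨c, hpc, hN.isAdaptedChart_of_functions hV (hN.contMDiff_arcCoord hV)
    (hN.contMDiff_transverseCoord hV) (hN.scalarDiff_arcCoord hV)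
    (hN.scalarDiff_transverseCoord_unitTangentPart hV hb) hc hcoord⟩

end IsConstantAngleSurface

end AdaptedChart

end ConstantAngle

end

open ConstantAngle
theorem corollary3p5 {N : Type*} [TopologicalSpace N] [ChartedSpace E2 N]
    [IsManifold (𝓡 2) ∞ N]
    (V : E3 → E3) (f : E3 → ℝ) (hV : IsUnitAntiTorqued V f)
    (φ U : N → E3) (θ : ℝ) (hN : IsConstantAngleSurface φ U V θ) (hθ : Real.cos θ ≠ 0) :
    ∃ (f₀ κ₁ : ℝ) (κ₂ : N → ℝ),
      -- the conformal scalar is constant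
      f₀ ≠ 0 ∧ (∀ x ∈ hyp, f x = f₀) ∧
      -- at every point, `κ₁` and `κ₂` are the principal curvatures, in the directions `T` and `e`
      ContMDiff (𝓡 2) 𝓘(ℝ, ℝ) ∞ κ₂ ∧
      (∀ p : N, ∃ e : TangentSpace (𝓡 2) p,
        inducedInner φ p (unitTangentPart φ U V p) (unitTangentPart φ U V p) = 1 ∧
        inducedInner φ p (unitTangentPart φ U V p) e = 0 ∧
        inducedInner φ p e e = 1 ∧
        shapeOperator φ U p (unitTangentPart φ U V p) = κ₁ • unitTangentPart φ U V p ∧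
        shapeOperator φ U p e = κ₂ p • e) ∧
      κ₁ = -Real.cos θ * f₀ ∧
      -- around every point there are coordinates `(s, t)` with `∂_s = T` and metric `ds² + λ² dt²`
      (∀ p : N, ∃ c : OpenPartialHomeomorph N E2, p ∈ c.source ∧ IsAdaptedChart φ U V c) ∧
      -- and in all such coordinates `κ₂` satisfies the differential equation
      (∀ c : OpenPartialHomeomorph N E2, IsAdaptedChart φ U V c → ∀ x ∈ c.target,
        HasLineDerivAt ℝ (fun y => κ₂ (c.symm y))
          (-(Real.sin θ)⁻¹ * (Real.cos θ * f₀ + κ₂ (c.symm x)) *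
            (Real.cos θ * κ₂ (c.symm x) + f₀))
          x (EuclideanSpace.single 0 (1 : ℝ) : E2)) := by
  choose κ hκ using hN.exists_secondCurvature hV
  exact ⟨f vert, -Real.cos θ * f vert, κ, hV.scalar_ne_zero _ vert_mem_hyp,
    fun x hx => hV.scalar_eq hx, hN.contMDiff_secondCurvature hV hκ,
    hN.exists_principal hV hκ, rfl, hN.exists_isAdaptedChart hV,
    fun c hc x hx => hN.hasLineDerivAt_secondCurvature hV hκ hc hx⟩
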